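/- Let $D=(V,A)$ be a finite acyclic directed graph (parallel arcs allowed), let $b\colon V\to\mathbb R$ satisfy $\sum_{v}b(v)=0$, and let $S^+=\{v: b(v)>0\}$ (sources), $S^-=\{v: b(v)<0\}$ (sinks). A \emph{$b$-transshipment} is an $x\in\mathbb R_{\ge 0}^A$ with $\sum_{a\in\delta^{\rm out}(v)}x_a-\sum_{a\in\delta^{\rm in}(v)}x_a=b(v)$ for all $v\in V$. It is \emph{unsplittable} if it comes with a decomposition into source--sink paths with positive flow values, with at most one path for each source--sink pair. Let a $b$-transshipment $x$ be given. \textbf{The Modified DGG Algorithm.} Add a super-source $s^*$ and dummy arcs $(s^*,s)$ with flow $x_{(s^*,s)}=b(s)$ for $s\in S^+$; put $d_t=|b(t)|$ for $t\in S^-$ and $y=x$. Throughout, the current network consists of the arcs $a$ with $y_a>0$. Every sink is initially located at its own vertex. Moving a (sub-)sink $t$ located at $v$ backward along an arc $a=(u,v)$ means to decrease $y_a$ by $d_t$ and to relocate $t$ to $u$. All choices below are arbitrary. \emph{Preliminary phase.} As long as some sink $t$, not yet at $s^*$, is located at the head of an arc $a$ with $y_a\ge d_t$, move such a $t$ along such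 an $a$. \emph{Iterations.} While some (sub-)sink has not reached $s^*$: Call an arc \emph{singular} if its head and all vertices reachable from its head have out-degree at most one, a vertex a \emph{funnel} if its out-degree is at most one, and a \emph{junction} if its out-degree is zero (all in the current network, at the beginning of the iteration). Search for an alternating cycle: from some vertex with an outgoing arc follow arbitrary arcs forward until a junction $w$ is reached, by an arc $a'$ say; from $w$ follow singular arcs backward, starting with an arc other than $a'$, up to a non-funnel vertex other than $s^*$; continue forward from there along an arc other than the one just used; and so on, never moving into $s^*$, until a vertex is revisited. One of the following is carried out. \begin{itemize} \item[(a)] If the search revisits a vertex, it has found a cycle $C$ (not containing $s^*$). Let $\varepsilon$ be the minimum of all $y_a$ with $a$ a forward arc of $C$ and of all $d_t-y_a$ with $a$ a backward arc of $C$ and $t$ a (sub-)sink located at the head of $a$ with $d_t>y_a$. Decrease $y$ by $\varepsilon$ on the forward arcs of $C$ and increase it by $\varepsilon$ on the backward arcs. \item[(b)] Or the search reaches a junction $w$ by an arc $a'$ such that the backward search from $w$, which ignores $a'$ and does not continue beyond non-funnel vertices, finds no non-funnel vertex other than $s^*$. The vertices found and the arcs other than $a'$ entering them form the \emph{singular digraph}.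 Choose a (sub-)sink $t$ at $w$ with $d_t>y_{a'}$ and split it into sub-sinks $t_1,t_2$ with demands $y_{a'}$ and $d_t-y_{a'}$. Decompose the flow $y$ on the singular digraph into paths from $s^*$ to $t_2$ and to the (sub-)sinks other than $t$ located at its vertices, serving their demands exactly; split each of these (sub-)sinks into one sub-sink for each path serving it, and move the sub-sinks along these paths to $s^*$; delete all arcs of the singular digraph. Then move $t_1$ along $a'$, which deletes $a'$. \end{itemize} After (a) or (b), as long as possible, move (sub-)sinks $t$ that have not reached $s^*$ along arcs $a$ entering their location that either were singular at the beginning of the iteration and satisfy $y_a=d_t$, or were non-singular and satisfy $y_a\ge d_t$. \emph{Output.} For every sink $t$, the set $\mathcal P_t$ of paths, without their dummy arcs, that were traced by $t$ or its sub-sinks from $t$ back to $s^*$, with the demands of these (sub-)sinks as flow values. \textbf{Lemma.} Whatever choices are made, the algorithm terminates after finitely many steps and never gets stuck before all (sub-)sinks have reached $s^*$. Its output is an unsplittable $b$-transshipment in which the demand of every sink $t$ is routed confluently: the paths in $\mathcal P_t$ carry total flow $|b(t)|$, and the arcs on these paths form an in-tree rooted at $t$, i.e., a directed tree with all arcs oriented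 toward $t$. -/

import Mathlib

noncomputable section

namespace UnsplittableTransshipment

/-! ### Networks, transshipments, path flows -/

/-- `IsWalk tail head u p v`: the arcs in the list `p`, traversed in order, lead from `u` to `v`. -/
def IsWalk {W E : Type*} (tail head : E → W) : W → List E → W → Prop
  | u, [], v => u = v
  | u, e :: p, v => tail e = u ∧ IsWalk tail head (head e) p v

/-- A directed graph with vertex set `V` and arc set `A` (parallel arcs are allowed), together with
a balance function `b`. -/
structure Network (V A : Type*) where
  tail : A → V
  head : A → V
  b : V → ℝ

namespace Network

variable {V A : Type*} (N : Network V A)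

/-- There is no directed cycle (in particular no loop). -/
def Acyclic : Prop := ∀ (v : V) (p : List A), IsWalk N.tail N.head v p v → p = []

/-- The set `S⁺` of sources. -/
abbrev Source : Type _ := {v : V // 0 < N.b v}

/-- The set `S⁻` of sinks. -/
abbrev Sink : Type _ := {v : V // N.b v < 0}

/-- `p` is a directed path from `u` to `v`: a walk that visits no vertex twice. -/
def IsPath (u : V) (p : List A) (v : V) : Prop :=
  IsWalk N.tail N.head u p v ∧ (u :: p.map N.head).Nodup

variable [Fintype V] [DecidableEq V] [Fintype A] [DecidableEq A]

/-- `x` is a `b`-transshipment: it is nonnegative, and outflow minus inflow is `b v` at every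
vertex `v`. -/
def IsTransshipment (x : A → ℝ) : Prop :=
  (∀ a, 0 ≤ x a) ∧
  ∀ v, (∑ a with N.tail a = v, x a) - (∑ a with N.head a = v, x a) = N.b v

/-- A path flow: for every sink `t`, the paths on which flow is sent to `t` (the support of `P t`)
together with the flow values on them. -/
abbrev PathFlow : Type _ := N.Sink → (List A →₀ ℝ)

/-- The total flow that a path flow sends along the arc `a`. -/
def arcFlow (P : N.PathFlow) (a : A) : ℝ :=
  ∑ t, (P t).sum fun p r => if a ∈ p then r else 0

/-- The path flow `P` is an unsplittable `b`-transshipment: its arc flow is a `b`-transshipment,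
it consists of source-sink paths with positive flow values, and it has at most one path for each
source-sink pair. -/
structure IsUnsplittable (P : N.PathFlow) : Prop where
  transshipment : N.IsTransshipment (N.arcFlow P)
  path : ∀ t, ∀ p ∈ (P t).support, 0 < P t p ∧ ∃ s : N.Source, N.IsPath s p t
  unique : ∀ (t : N.Sink) (s : N.Source), ∀ p ∈ (P t).support, ∀ q ∈ (P t).support,
    N.IsPath s p t → N.IsPath s q t → p = q

/-- The arcs in `U` form an in-tree with root `r`: no arc of `U` leaves `r`, no two arcs of `U`
leave the same vertex, and from every arc of `U` one reaches `r` along arcs of `U`. -/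
structure IsInTree (U : Set A) (r : V) : Prop where
  root : ∀ a ∈ U, N.tail a ≠ r
  unique : ∀ a ∈ U, ∀ a' ∈ U, N.tail a = N.tail a' → a = a'
  reach : ∀ a ∈ U, ∃ p : List A, IsWalk N.tail N.head (N.head a) p r ∧ ∀ e ∈ p, e ∈ U

/-- The demand of the sink `t` is routed confluently: the paths to `t` carry exactly the demand
`|b t|`, and the arcs carrying flow to `t` form an in-tree rooted at `t`. -/
def RoutedConfluently (P : N.PathFlow) (t : N.Sink) : Prop :=
  ((P t).sum fun _ r => r) = |N.b t| ∧
  N.IsInTree {a | ∃ p ∈ (P t).support, a ∈ p} t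

/-! ### The network with a super-source

The super-source `s*` is `none`; there is a dummy arc `Sum.inr s` from it to every source `s`. -/

/-- The arcs of the extended network. -/
abbrev Arc : Type _ := A ⊕ N.Source

/-- The tail of an arc of the extended network. -/
def tl : N.Arc → Option V
  | .inl a => some (N.tail a)
  | .inr _ => none

/-- The head of an arc of the extended network. -/
def hd : N.Arc → Option V
  | .inl a => some (N.head a)
  | .inr s => some s

/-! An arc is deleted as soon as its flow is zero, so the current network consists of the arcs `a`
with `0 < y a`, where `y` is the current flow. -/

/-- The outgoing arcs of `v` in the current network. -/
def outArcs (y : N.Arc → ℝ) (v : Option V) : Set N.Arc := {a | 0 < y a ∧ N.tl a = v}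

/-- A junction vertex has no outgoing arc. -/
def IsJunction (y : N.Arc → ℝ) (v : Option V) : Prop := N.outArcs y v = ∅

/-- A funnel vertex has at most one outgoing arc. -/
def IsFunnel (y : N.Arc → ℝ) (v : Option V) : Prop := (N.outArcs y v).Subsingleton

/-- `v` is reachable from `u` in the current network. -/
def Reach (y : N.Arc → ℝ) : Option V → Option V → Prop :=
  Relation.ReflTransGen fun u v => ∃ a, 0 < y a ∧ N.tl a = u ∧ N.hd a = v

/-- An arc is singular if its head and all vertices reachable from its head have out-degree at most
one. -/
def IsSingular (y : N.Arc → ℝ) (a : N.Arc) : Prop :=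
  0 < y a ∧ ∀ v, N.Reach y (N.hd a) v → N.IsFunnel y v

/-! ### States of the algorithm -/

/-- A state of the algorithm. At any time at most one (sub-)sink of a sink `t` has not yet reached
the super-source; it is described by `dem t` and `trace t`. -/
structure State where
  /-- The current flow. -/
  flow : N.Arc → ℝ
  /-- The demand of the (sub-)sink of `t` that is still under way; it is zero if there is none. -/
  dem : N.Sink → ℝ
  /-- The arcs along which this (sub-)sink was moved so far, ordered from its current location
  to `t`. -/
  trace : N.Sink → List N.Arc
  /-- The paths from the super-source to `t` traced by those (sub-)sinks of `t` that have reached the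
  super-source, with their demands. -/
  routed : N.Sink → (List N.Arc →₀ ℝ)

/-- The initial state for the fractional transshipment `x`. -/
def init (x : A → ℝ) : N.State where
  flow := Sum.elim x fun s => N.b s
  dem t := |N.b t|
  trace _ := []
  routed _ := 0

namespace State

variable {N}

/-- Some (sub-)sink of `t` has not yet reached the super-source. -/
def Active (σ : N.State) (t : N.Sink) : Prop := 0 < σ.dem t

/-- The current location of the (sub-)sink of `t` that is under way. -/
def loc (σ : N.State) (t : N.Sink) : Option V :=
  match σ.trace t with
  | [] => some t
  | a :: _ => N.tl a

/-- Move the (sub-)sink of `t` backward along the arc `a`. -/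
def move (σ : N.State) (t : N.Sink) (a : N.Arc) : N.State where
  flow := Function.update σ.flow a (σ.flow a - σ.dem t)
  trace := Function.update σ.trace t (a :: σ.trace t)
  dem := if N.tl a = none then Function.update σ.dem t 0 else σ.dem
  routed :=
    if N.tl a = none then
      Function.update σ.routed t (σ.routed t + Finsupp.single (a :: σ.trace t) (σ.dem t))
    else σ.routed

/-! #### Nice alternating cycles -/

/-- A step of an alternating trail: traverse the arc in forward or in backward direction. -/
structure TrailStep (N : Network V A) where
  arc : N.Arc
  forward : Bool

/-- The vertex at which the step starts. -/
def TrailStep.src (e : TrailStep N) : Option V := if e.forward then N.tl e.arc else N.hd e.arc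

/-- The vertex at which the step ends. -/
def TrailStep.tgt (e : TrailStep N) : Option V := if e.forward then N.hd e.arc else N.tl e.arc

/-- The step `f` may follow the step `e`: one changes from forward to backward at a junction vertex,
and from backward to forward at a non-funnel vertex, and always leaves along a different arc. -/
def TrailStep.Next (y : N.Arc → ℝ) (e f : TrailStep N) : Prop :=
  e.tgt = f.src ∧ e.arc ≠ f.arc ∧
  (e.forward = true → f.forward = false → N.IsJunction y e.tgt) ∧
  (e.forward = false → f.forward = true → ¬ N.IsFunnel y e.tgt)

/-- The alternating search, started with a forward path from some vertex, makes the steps `l`: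
forward along arbitrary arcs, backward along singular arcs, without moving into the super-source. -/
structure IsTrail (y : N.Arc → ℝ) (l : List (TrailStep N)) : Prop where
  chain : l.IsChain (TrailStep.Next y)
  start : ∀ e ∈ l.head?, e.forward = true
  pos : ∀ e ∈ l, 0 < y e.arc
  singular : ∀ e ∈ l, e.forward = false → N.IsSingular y e.arc
  ne_super : ∀ e ∈ l, e.tgt ≠ none

/-- The search finds the nice alternating cycle `C`: after the steps `l ++ C` it revisits a vertex
for the first time, namely the first vertex of `C`. -/
structure FindsCycle (y : N.Arc → ℝ) (C : List (TrailStep N)) : Prop where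
  nonempty : C ≠ []
  trail : ∃ l, IsTrail y (l ++ C) ∧ ((l ++ C).map TrailStep.src).Nodup
  closed : C.getLast?.map TrailStep.tgt = C.head?.map TrailStep.src

/-- The arcs traversed forward, resp. backward, by `C`. -/
def cycleArcs (C : List (TrailStep N)) (forward : Bool) : Set N.Arc :=
  {a | (⟨a, forward⟩ : TrailStep N) ∈ C}

/-- The augmentation amount is the minimum of the numbers in this set: the flow values on forward
arcs, and the differences `d_t - y_a` for backward arcs `a` and (sub-)sinks `t` located at the head
of `a` with `d_t > y_a`. -/
def augmentBounds (σ : N.State) (C : List (TrailStep N)) : Set ℝ :=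
  {r | ∃ a ∈ cycleArcs C true, r = σ.flow a} ∪
  {r | ∃ a ∈ cycleArcs C false, ∃ t, σ.Active t ∧ σ.loc t = N.hd a ∧ σ.flow a < σ.dem t ∧
    r = σ.dem t - σ.flow a}

open Classical in
/-- Decrease the flow by `ε` on forward arcs and increase it by `ε` on backward arcs. -/
def augment (σ : N.State) (C : List (TrailStep N)) (ε : ℝ) : N.State :=
  { σ with flow := fun a =>
      σ.flow a - (if a ∈ cycleArcs C true then ε else 0)
        + (if a ∈ cycleArcs C false then ε else 0) }

/-! #### Singular digraphs -/

/-- The vertices found by the backward search that starts at the head of `a'`, ignores the arc `a'`,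
and does not continue beyond non-funnel vertices. -/
def BackReach (y : N.Arc → ℝ) (a' : N.Arc) (v : Option V) : Prop :=
  Relation.ReflTransGen
    (fun u v => N.IsFunnel y u ∧ ∃ a, 0 < y a ∧ a ≠ a' ∧ N.hd a = u ∧ N.tl a = v) (N.hd a') v

/-- The search reaches a junction vertex `w` along the arc `a'`, and no non-funnel vertex other than
the super-source is found by the backward search from `w`. -/
structure FindsSingularDigraph (y : N.Arc → ℝ) (a' : N.Arc) : Prop where
  pos : 0 < y a'
  junction : N.IsJunction y (N.hd a')
  funnel : ∀ v, BackReach y a' v → v ≠ none → N.IsFunnel y v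

/-- The arcs of the singular digraph. -/
def digraphArcs (y : N.Arc → ℝ) (a' : N.Arc) : Set N.Arc :=
  {a | 0 < y a ∧ a ≠ a' ∧ BackReach y a' (N.hd a)}

open Classical in
/-- The demand to be routed in the singular digraph for the (sub-)sink of `j`, if `t` is the chosen
(sub-)sink at the root: `d_j` if it is located at a vertex of the singular digraph and `j ≠ t`, and
`d_t - y_{a'}` (the demand of the sub-sink `t₂`) for `j = t`. -/
def digraphDem (σ : N.State) (a' : N.Arc) (t j : N.Sink) : ℝ :=
  if j = t then σ.dem t - σ.flow a'
  else if σ.Active j ∧ BackReach σ.flow a' (σ.loc j) then σ.dem j else 0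

open Classical in
/-- `F` is a path decomposition of the flow on the singular digraph: `F j` gives the paths from the
super-source that serve the (sub-)sink of `j`, with positive flow values. -/
structure IsDecomposition (σ : N.State) (a' : N.Arc) (t : N.Sink)
    (F : N.Sink → (List N.Arc →₀ ℝ)) : Prop where
  path : ∀ j, ∀ p ∈ (F j).support, 0 < F j p ∧ IsWalk N.tl N.hd none p (σ.loc j) ∧
    ∀ a ∈ p, a ∈ digraphArcs σ.flow a'
  demand : ∀ j, ((F j).sum fun _ r => r) = σ.digraphDem a' t j
  flow : ∀ a ∈ digraphArcs σ.flow a',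
    ∑ j, ((F j).sum fun p r => if a ∈ p then r else 0) = σ.flow a

open Classical in
/-- Route all (sub-)sinks in the singular digraph (and the sub-sink `t₂` of `t`) to the super-source
along the paths of `F` and remove all arcs of the singular digraph. Of these (sub-)sinks only the
sub-sink `t₁` of `t` is left, with demand `y_{a'}`. -/
def routeDigraph (σ : N.State) (a' : N.Arc) (t : N.Sink) (F : N.Sink → (List N.Arc →₀ ℝ)) :
    N.State where
  flow a := if a ∈ digraphArcs σ.flow a' then 0 else σ.flow a
  dem j :=
    if j = t then σ.flow a'
    else if BackReach σ.flow a' (σ.loc j) then 0 else σ.dem j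
  trace := σ.trace
  routed j := σ.routed j + (F j).mapDomain fun p => p ++ σ.trace j

/-! #### Moving rules -/

/-- In the preliminary phase, `t` may be moved along `a`. -/
def CanMovePrelim (σ : N.State) (t : N.Sink) (a : N.Arc) : Prop :=
  σ.Active t ∧ 0 < σ.flow a ∧ N.hd a = σ.loc t ∧ σ.dem t ≤ σ.flow a

/-- At the end of an iteration, `t` may be moved along `a`: along a singular arc carrying exactly its
demand, or along a non-singular arc carrying at least its demand. The arcs are labeled according to
the flow `y₀` at the beginning of the iteration. (All arcs into a vertex have the same label, so that
the two rules never compete.) -/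
def CanMove (y₀ : N.Arc → ℝ) (σ : N.State) (t : N.Sink) (a : N.Arc) : Prop :=
  σ.Active t ∧ 0 < σ.flow a ∧ N.hd a = σ.loc t ∧
  ((N.IsSingular y₀ a ∧ σ.flow a = σ.dem t) ∨ (¬ N.IsSingular y₀ a ∧ σ.dem t ≤ σ.flow a))

/-- The path flow in the original network that is defined by the traced paths: the leading dummy arc
of every path is dropped. -/
def output (σ : N.State) : N.PathFlow := fun t =>
  (σ.routed t).mapDomain fun p => p.filterMap Sum.getLeft?

/-- All (sub-)sinks have reached the super-source. -/
def Finished (σ : N.State) : Prop := ∀ t, ¬ σ.Active t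

end State

/-! ### The algorithm -/

/-- Configurations of the algorithm: a state, and the position in the program. -/
inductive Config
  /-- in the preliminary phase -/
  | prelim (σ : N.State)
  /-- at the head of the main loop -/
  | loop (σ : N.State)
  /-- at the end of an iteration that began with the flow `y₀`: (sub-)sinks are being moved -/
  | moving (y₀ : N.Arc → ℝ) (σ : N.State)

variable {N}

open State in
/-- One step of the Modified DGG Algorithm. All its choices (of sinks, arcs, start vertices, paths,
decompositions) are left open. -/
inductive Step : N.Config → N.Config → Prop
  | prelim_move {σ : N.State} {t : N.Sink} {a : N.Arc} (h : σ.CanMovePrelim t a) :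
      Step (.prelim σ) (.prelim (σ.move t a))
  | prelim_end {σ : N.State} (h : ∀ t a, ¬ σ.CanMovePrelim t a) :
      Step (.prelim σ) (.loop σ)
  | cycle {σ : N.State} {C : List (TrailStep N)} {ε : ℝ} (hσ : ¬ σ.Finished)
      (hC : FindsCycle σ.flow C) (hε : IsLeast (σ.augmentBounds C) ε) :
      Step (.loop σ) (.moving σ.flow (σ.augment C ε))
  | singular {σ : N.State} {a' : N.Arc} {t : N.Sink} {F : N.Sink → (List N.Arc →₀ ℝ)}
      (hσ : ¬ σ.Finished) (ha' : FindsSingularDigraph σ.flow a')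
      (ht : σ.Active t ∧ σ.loc t = N.hd a' ∧ σ.flow a' < σ.dem t)
      (hF : σ.IsDecomposition a' t F) :
      Step (.loop σ) (.moving σ.flow ((σ.routeDigraph a' t F).move t a'))
  | move {y₀ : N.Arc → ℝ} {σ : N.State} {t : N.Sink} {a : N.Arc} (h : σ.CanMove y₀ t a) :
      Step (.moving y₀ σ) (.moving y₀ (σ.move t a))
  | move_end {y₀ : N.Arc → ℝ} {σ : N.State} (h : ∀ t a, ¬ σ.CanMove y₀ t a) :
      Step (.moving y₀ σ) (.loop σ)

/-- `c` occurs in some execution on the fractional transshipment `x`. -/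
def Reachable (x : A → ℝ) (c : N.Config) : Prop :=
  Relation.ReflTransGen Step (.prelim (N.init x)) c

end Network

end UnsplittableTransshipment

end

set_option linter.unusedSectionVars false

namespace UnsplittableTransshipment

/-! Two invariants carry the proof. By `State.Consistent`, the remaining flow serves the remaining
demands at their current locations, and no two arcs used for the same sink leave a common vertex
other than the super-source. This survives because each used arc not leaving the super-source lies
on the current trace, so that its tail ranks at least as high as the current location, or has a tail
that no flow leaves any more. A newly used arc carries flow and its tail ranks strictly below the
location, so it collides with neither kind. Inside a singular digraph, collisions are excluded
because its vertices other than the super-source are funnels.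

`State.Tame` excludes deadlock: irregular sinks sit only at junctions, at most one at each. At the
head of the loop no demand equals the flow on an arc entering its location. Hence, if no sink at a
junction demanded more than the flow on an entering arc, all of them would be irregular, so there
would be just one, too small to absorb that flow (`Tame.exists_large_sink`). A singular digraph can
therefore always be processed, its flow being decomposed by `exists_flow_decomposition`. If there is
none, every search step can be continued, and the pigeonhole principle yields a cycle
(`exists_cycle`). Augmentation keeps tameness by the choice of `ε`. During the final moves tameness
is tracked only at vertices that were singular when the iteration began; an irregular sink anywhere
else could still move.

For termination, every move lengthens a trace, which is a path, and every augmentation deletes an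
arc or enables a move (`Config.Invariant.measure_lt`). In the end all demands are zero, so
acyclicity forces the dummy arcs to be empty: every source is exhausted. Confluence then leaves at
most one path per source-sink pair. -/

theorem sum_filter_ite_eq {ι β : Type*} [Fintype ι] [DecidableEq ι] [DecidableEq β] (f : ι → β)
    (i : ι) (x : β) (r : ℝ) :
    (∑ j with f j = x, if j = i then r else 0) = if f i = x then r else 0 := by
  rw [Finset.sum_ite_eq']
  simp

/-! ### Walks in ranked digraphs -/

section Walk

variable {W E : Type*} {tail head : E → W}

theorem isWalk_append {u w : W} {p q : List E} :
    IsWalk tail head u (p ++ q) w ↔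
      ∃ v, IsWalk tail head u p v ∧ IsWalk tail head v q w := by
  induction p generalizing u with
  | nil => simp [IsWalk]
  | cons e p ih => simp [IsWalk, ih, and_assoc]

theorem IsWalk.append {u v w : W} {p q : List E} (hp : IsWalk tail head u p v)
    (hq : IsWalk tail head v q w) : IsWalk tail head u (p ++ q) w :=
  isWalk_append.2 ⟨v, hp, hq⟩

theorem isWalk_singleton (e : E) : IsWalk tail head (tail e) [e] (head e) := ⟨rfl, rfl⟩

variable {rk : W → ℕ} (hrk : ∀ e, rk (tail e) < rk (head e))

include hrk

theorem IsWalk.rank_le {u v : W} {p : List E} (hp : IsWalk tail head u p v) : rk u ≤ rk v := by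
  induction p generalizing u with
  | nil => exact le_of_eq (congrArg rk hp)
  | cons e p ih => exact (hp.1 ▸ (hrk e).le).trans (ih hp.2)

theorem IsWalk.rank_mem {u v : W} {p : List E} (hp : IsWalk tail head u p v) {e : E}
    (he : e ∈ p) : rk u ≤ rk (tail e) ∧ rk (head e) ≤ rk v := by
  obtain ⟨q, q', rfl⟩ := List.append_of_mem he
  obtain ⟨x, hq, hx, hq'⟩ := isWalk_append.1 hp
  exact ⟨hx ▸ hq.rank_le hrk, hq'.rank_le hrk⟩

/-- Ranks strictly increase along a walk, so no vertex can recur. -/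
theorem IsWalk.nodup_vertices {u v : W} {p : List E} (hp : IsWalk tail head u p v) :
    (u :: p.map head).Nodup := by
  induction p generalizing u with
  | nil => simp
  | cons e p ih =>
    refine List.nodup_cons.2 ⟨?_, ih hp.2⟩
    intro hu
    obtain ⟨e', he', h⟩ := List.mem_map.1 hu
    have h1 := (IsWalk.rank_mem hrk hp he').1
    have h2 := hrk e'
    rw [h] at h2
    omega

theorem IsWalk.nodup {u v : W} {p : List E} (hp : IsWalk tail head u p v) : p.Nodup :=
  (List.nodup_cons.1 (hp.nodup_vertices hrk)).2.of_map

open Classical in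
/-- Sending one unit of flow along a walk changes the net outflow only at its ends. -/
theorem IsWalk.balance [Fintype E] [DecidableEq W] {u v : W} {p : List E}
    (hp : IsWalk tail head u p v) (r : ℝ) (x : W) :
    (∑ e with tail e = x, if e ∈ p then r else 0) - (∑ e with head e = x, if e ∈ p then r else 0)
      = (if u = x then r else 0) - (if v = x then r else 0) := by
  induction p generalizing u with
  | nil => cases hp; simp
  | cons e p ih =>
    -- Arcs do not repeat, so the membership indicator counts each traversal exactly once.
    have hnd := List.nodup_cons.1 (hp.nodup hrk)
    have key : ∀ (f : E → W), (∑ e' with f e' = x, if e' ∈ e :: p then r else 0)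
        = (if f e = x then r else 0) + ∑ e' with f e' = x, if e' ∈ p then r else 0 := by
      intro f
      rw [← sum_filter_ite_eq, ← Finset.sum_add_distrib]
      refine Finset.sum_congr rfl fun e' _ => ?_
      by_cases h : e' = e
      · subst h; simp [hnd.1]
      · simp [h]
    have := ih hp.2
    rw [key, key, hp.1]
    linarith

/-- Two walks with the same ends coincide if no vertex offers a choice. -/
theorem IsWalk.eq_of_unique {u v : W} {p q : List E} (hp : IsWalk tail head u p v)
    (hq : IsWalk tail head u q v)
    (h : ∀ e ∈ p, ∀ e' ∈ q, tail e = tail e' → e = e') : p = q := by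
  induction p generalizing u q with
  | nil =>
    cases q with
    | nil => rfl
    | cons e q =>
      have h1 := IsWalk.rank_le hrk hq.2
      have h2 := hrk e
      rw [hq.1, show u = v from hp] at h2
      omega
  | cons e p ih =>
    cases q with
    | nil =>
      have h1 := IsWalk.rank_le hrk hp.2
      have h2 := hrk e
      rw [hp.1, show u = v from hq] at h2
      omega
    | cons e' q =>
      obtain rfl := h e (by simp) e' (by simp) (hp.1.trans hq.1.symm)
      rw [ih hp.2 hq.2 fun a ha a' ha' => h a (by simp [ha]) a' (by simp [ha'])]

end Walk

/-! ### Path decomposition of flows -/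

section Decomposition

variable {W E J : Type*} [DecidableEq W] [Fintype E] [Fintype J] [DecidableEq J]
  {tail head : E → W} {rk : W → ℕ}

omit [DecidableEq W] [Fintype E] in
-- Going back through predecessors lowers the rank, so it must stop, and it can only stop at `r`.
theorem exists_walk_from_root (hrk : ∀ e, rk (tail e) < rk (head e)) {r : W} {S : Set E}
    (hS : ∀ e ∈ S, tail e ≠ r → ∃ e' ∈ S, head e' = tail e) {e : E} (he : e ∈ S) :
    ∃ p, IsWalk tail head r p (head e) ∧ ∀ e' ∈ p, e' ∈ S := by
  induction h : rk (tail e) using Nat.strong_induction_on generalizing e with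
  | _ n ih =>
    by_cases hr : tail e = r
    · exact ⟨[e], hr ▸ isWalk_singleton e, by simpa using he⟩
    · obtain ⟨e', he', h'⟩ := hS e he hr
      obtain ⟨p, hp, hpS⟩ := ih _ (h ▸ h' ▸ hrk e') he' rfl
      refine ⟨p ++ [e], hp.append ⟨h'.symm, rfl⟩, ?_⟩
      simp only [List.mem_append, List.mem_singleton]
      rintro a (ha | rfl)
      exacts [hpS a ha, he]

omit [Fintype E] in
-- Take the minimum of `c` and the values of `f` on `p`. The last alternative says that subtracting
-- it makes the demand or some arc vanish.
theorem exists_bottleneck (f : E → ℝ) (p : List E) (c : ℝ) (hc : 0 < c) (hp : ∀ e ∈ p, 0 < f e) :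
    ∃ θ, 0 < θ ∧ θ ≤ c ∧ (∀ e ∈ p, θ ≤ f e) ∧ (θ = c ∨ ∃ e ∈ p, θ = f e) := by
  induction p with
  | nil => exact ⟨c, hc, le_rfl, by simp, .inl rfl⟩
  | cons e p ih =>
    obtain ⟨θ, h0, h1, h2, h3⟩ := ih fun a ha => hp a (by simp [ha])
    rcases le_total θ (f e) with h | h
    · refine ⟨θ, h0, h1, by simpa [h] using h2, h3.imp_right ?_⟩
      rintro ⟨a, ha, rfl⟩
      exact ⟨a, by simp [ha], rfl⟩
    · refine ⟨f e, hp e (by simp), h.trans h1, ?_, .inr ⟨e, by simp, rfl⟩⟩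
      simp only [List.mem_cons]
      rintro a (rfl | ha)
      exacts [le_rfl, h.trans (h2 a ha)]

open Classical in
/-- A flow in an acyclic digraph that has its only source at `r` and serves the demands `d j` at
the vertices `ℓ j` decomposes into walks. -/
theorem exists_flow_decomposition (hrk : ∀ e, rk (tail e) < rk (head e)) {r : W}
    (hroot : ∀ e, head e ≠ r) (ℓ : J → W) (f : E → ℝ) (d : J → ℝ) (hf : ∀ e, 0 ≤ f e)
    (hd : ∀ j, 0 ≤ d j) (hℓ : ∀ j, 0 < d j → ℓ j ≠ r)
    (hbal : ∀ v, v ≠ r →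
      (∑ e with head e = v, f e) - (∑ e with tail e = v, f e) = ∑ j with ℓ j = v, d j) :
    ∃ F : J → (List E →₀ ℝ),
      (∀ j, ∀ p ∈ (F j).support, 0 < F j p ∧ IsWalk tail head r p (ℓ j) ∧ ∀ e ∈ p, 0 < f e) ∧
      (∀ j, ((F j).sum fun _ s => s) = d j) ∧
      ∀ e, ∑ j, ((F j).sum fun p s => if e ∈ p then s else 0) = f e := by
  -- Peeling off one walk with its bottleneck value empties an arc or satisfies a demand, which
  -- lowers this count.
  induction hn : Finset.card {e | 0 < f e} + Finset.card {j | 0 < d j} using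
    Nat.strong_induction_on generalizing f d with
  | _ n ih =>
  by_cases hj : ∃ j, 0 < d j
  · obtain ⟨j, hj⟩ := hj
    have hin : ∀ v, v ≠ r → 0 < (∑ e with tail e = v, f e) + ∑ j with ℓ j = v, d j →
        ∃ e, 0 < f e ∧ head e = v := by
      intro v hv h
      have : 0 < ∑ e with head e = v, f e := by linarith [hbal v hv]
      obtain ⟨e, he, h⟩ := Finset.exists_lt_of_sum_lt
        (s := {e | head e = v}) (f := fun _ => (0 : ℝ)) (g := f) (by simpa using this)
      exact ⟨e, h, by simpa using he⟩
    obtain ⟨e₀, he₀, hℓ₀⟩ := hin (ℓ j) (hℓ j hj) (add_pos_of_nonneg_of_pos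
      (Finset.sum_nonneg fun e _ => hf e)
      (Finset.sum_pos' (fun j _ => hd j) ⟨j, by simp, hj⟩))
    obtain ⟨p, hp, hpf⟩ := exists_walk_from_root (r := r) (S := {e | 0 < f e}) hrk
      (fun e he hr => hin _ hr (add_pos_of_pos_of_nonneg
        (Finset.sum_pos' (fun e _ => hf e) ⟨e, by simp, he⟩)
        (Finset.sum_nonneg fun j _ => hd j))) he₀
    rw [hℓ₀] at hp
    obtain ⟨θ, hθ, hθj, hθp, hθe⟩ := exists_bottleneck f p (d j) hj hpf
    have hf' : ∀ e, 0 ≤ f e - if e ∈ p then θ else 0 := by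
      intro e
      split_ifs with h
      · linarith [hθp e h]
      · linarith [hf e]
    have hd' : ∀ i, 0 ≤ d i - if i = j then θ else 0 := by
      intro i
      split_ifs with h
      · subst h; linarith
      · linarith [hd i]
    have hfle : ∀ e, 0 < (f e - if e ∈ p then θ else 0) → 0 < f e := by
      intro e; split_ifs <;> intro <;> linarith
    have hdle : ∀ i, 0 < (d i - if i = j then θ else 0) → 0 < d i := by
      intro e; split_ifs <;> intro <;> linarith
    obtain ⟨F, hF, hFd, hFf⟩ := ih _ (by
        rw [← hn]
        have h1 : ({e | 0 < (f e - if e ∈ p then θ else 0)} : Finset E)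
            ⊆ ({e | 0 < f e} : Finset E) := by
          intro e; simpa using hfle e
        have h2 : ({i | 0 < (d i - if i = j then θ else 0)} : Finset J)
            ⊆ ({j | 0 < d j} : Finset J) := by
          intro e; simpa using hdle e
        rcases hθe with h | ⟨e, he, h⟩
        · refine add_lt_add_of_le_of_lt (Finset.card_le_card h1) (Finset.card_lt_card
            (Finset.ssubset_iff_subset_ne.2 ⟨h2, fun h' => ?_⟩))
          have : j ∈ ({j | 0 < d j} : Finset J) := by simpa using hj
          rw [← h'] at this
          simp [h] at this
        · refine add_lt_add_of_lt_of_le (Finset.card_lt_card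
            (Finset.ssubset_iff_subset_ne.2 ⟨h1, fun h' => ?_⟩)) (Finset.card_le_card h2)
          have : e ∈ ({e | 0 < f e} : Finset E) := by simpa using hpf e he
          rw [← h'] at this
          simp [h, he] at this)
      (fun e => f e - if e ∈ p then θ else 0) (fun i => d i - if i = j then θ else 0) hf' hd'
      (fun i hi => hℓ i (hdle i hi)) (by
        intro v hv
        have h1 := hp.balance hrk θ v
        rw [if_neg (Ne.symm hv)] at h1
        have h2 : (∑ i with ℓ i = v, if i = j then θ else 0) = if ℓ j = v then θ else 0 :=
          sum_filter_ite_eq ℓ j v θ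
        simp only [Finset.sum_sub_distrib, h2]
        linarith [hbal v hv]) rfl
    -- The walk `p` may already occur in `F j`; its values are then merged.
    refine ⟨fun i => F i + if i = j then Finsupp.single p θ else 0, ?_, ?_, ?_⟩
    · intro i q hq
      have hFnn : ∀ q, 0 ≤ F i q := fun q => by
        by_cases h : q ∈ (F i).support
        · exact (hF i q h).1.le
        · rw [Finsupp.notMem_support_iff.1 h]
      have hold : q ∈ (F i).support →
          IsWalk tail head r q (ℓ i) ∧ ∀ e ∈ q, 0 < f e := fun h =>
        ⟨(hF i q h).2.1, fun e he => hfle e ((hF i q h).2.2 e he)⟩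
      by_cases hi : i = j
      · subst hi
        simp only [if_true, Finsupp.mem_support_iff, Finsupp.add_apply, ne_eq] at hq ⊢
        by_cases hqp : p = q
        · subst hqp
          exact ⟨by simpa using add_pos_of_nonneg_of_pos (hFnn p) hθ, hp, hpf⟩
        · rw [Finsupp.single_eq_of_ne (Ne.symm hqp), add_zero] at hq ⊢
          have hq' := Finsupp.mem_support_iff.2 hq
          exact ⟨(hF i q hq').1, hold hq'⟩
      · simp only [hi, if_false, add_zero] at hq ⊢
        exact ⟨(hF i q hq).1, hold hq⟩
    · intro i
      rw [Finsupp.sum_add_index' (by simp) (by simp), hFd]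
      by_cases hi : i = j <;> simp [hi]
    · intro e
      have h1 : ∀ i, ((F i + if i = j then Finsupp.single p θ else 0).sum
          fun q s => if e ∈ q then s else 0) = ((F i).sum fun q s => if e ∈ q then s else 0)
            + if i = j then (if e ∈ p then θ else 0) else 0 := by
        intro i
        rw [Finsupp.sum_add_index' (by simp) (by intro a b c; split_ifs <;> simp)]
        by_cases hi : i = j <;> simp [hi]
      simp only [h1, Finset.sum_add_distrib, hFf]
      simp
  · push Not at hj
    have hd0 : ∀ j, d j = 0 := fun j => le_antisymm (hj j) (hd j)
    have hf0 : ∀ e, f e = 0 := by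
      intro e
      by_contra hne
      have he : 0 < f e := lt_of_le_of_ne (hf e) (Ne.symm hne)
      -- Without demands, flow entering the highest-ranked head would have to continue to a still
      -- higher one.
      obtain ⟨e, he, hmax⟩ := Finset.exists_max_image ({e | 0 < f e} : Finset E)
        (fun e => rk (head e)) ⟨e, by simpa using he⟩
      have he : 0 < f e := by simpa using he
      have h1 := hbal _ (hroot e)
      simp only [hd0, Finset.sum_const_zero] at h1
      have h2 : 0 < ∑ e' with head e' = head e, f e' :=
        Finset.sum_pos' (fun e _ => hf e) ⟨e, by simp, he⟩
      obtain ⟨e', he', h⟩ := Finset.exists_lt_of_sum_lt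
        (s := {e' | tail e' = head e}) (f := fun _ => (0 : ℝ)) (g := f)
        (by simp only [Finset.sum_const_zero]; linarith)
      have h3 := hmax e' (by simpa using h)
      have h4 := hrk e'
      rw [show tail e' = head e by simpa using he'] at h4
      omega
    exact ⟨0, by simp, by simp [hd0], by simp [hf0]⟩

end Decomposition

/-! ### Ranking the extended network -/

namespace Network

variable {V A : Type*} {N : Network V A}

theorem tl_eq_none {a : N.Arc} : N.tl a = none ↔ ∃ s, a = .inr s := by
  cases a <;> simp [tl]

theorem hd_ne_none (a : N.Arc) : N.hd a ≠ none := by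
  cases a <;> simp [hd]

/-- The vertices of the extended network can be ranked such that every arc leads to a vertex of
higher rank. -/
theorem Acyclic.exists_rank [Finite V] (hN : N.Acyclic) :
    ∃ rk : Option V → ℕ, ∀ a : N.Arc, rk (N.tl a) < rk (N.hd a) := by
  have hlt : ∀ a, {u | ∃ p, IsWalk N.tail N.head u p (N.tail a)}
      ⊂ {u | ∃ p, IsWalk N.tail N.head u p (N.head a)} := by
    intro a
    refine (Set.ssubset_iff_of_subset ?_).2 ⟨N.head a, ⟨[], rfl⟩, ?_⟩
    · rintro u ⟨p, hp⟩
      exact ⟨p ++ [a], hp.append (isWalk_singleton a)⟩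
    · rintro ⟨p, hp⟩
      simpa using hN _ _ (hp.append (isWalk_singleton a))
  -- The rank of a vertex is the number of vertices that reach it. This is at least one, as the
  -- vertex reaches itself, which leaves rank zero for the super-source.
  refine ⟨fun v => v.elim 0 fun v => {u | ∃ p, IsWalk N.tail N.head u p v}.ncard, ?_⟩
  rintro (a | s)
  · exact Set.ncard_lt_ncard (hlt a) (Set.toFinite _)
  · exact (Set.ncard_pos (Set.toFinite _)).2 ⟨s, [], rfl⟩

end Network

end UnsplittableTransshipment

namespace UnsplittableTransshipment

open Finset

theorem sum_subtype_ite_eq {V : Type*} [Fintype V] [DecidableEq V] (p : V → Prop)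
    [DecidablePred p] (f : V → ℝ) (v : V) :
    (∑ s : {v // p v}, if s.1 = v then f s.1 else 0) = if p v then f v else 0 := by
  split_ifs with hv
  · rw [Finset.sum_eq_single (⟨v, hv⟩ : {v // p v})]
    · simp
    · intro s _ hs
      exact if_neg fun h => hs (Subtype.ext h)
    · simp
  · exact Finset.sum_eq_zero fun s _ => if_neg fun h : s.1 = v => hv (h ▸ s.2)

/-! ### The consistency invariant -/

namespace Network

variable {V A : Type*} {N : Network V A} [Fintype V] [DecidableEq V] [Fintype A] [DecidableEq A]

namespace State

/-- The arcs that were used by the (sub-)sinks of `t` so far. -/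
def used (σ : N.State) (t : N.Sink) : Set N.Arc :=
  {a | a ∈ σ.trace t ∨ ∃ p ∈ (σ.routed t).support, a ∈ p}

open Classical in
/-- The flow serves the current demands, and all traced paths fit together confluently. -/
structure Consistent (σ : N.State) : Prop where
  flow_nonneg : ∀ a, 0 ≤ σ.flow a
  dem_nonneg : ∀ t, 0 ≤ σ.dem t
  balance : ∀ v, v ≠ none → (∑ a with N.hd a = v, σ.flow a) - (∑ a with N.tl a = v, σ.flow a)
    = ∑ t with σ.loc t = v, σ.dem t
  trace_walk : ∀ t : N.Sink, IsWalk N.tl N.hd (σ.loc t) (σ.trace t) (some t.1)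
  loc_ne : ∀ t, σ.Active t → σ.loc t ≠ none
  routed_nonneg : ∀ t, 0 ≤ σ.routed t
  routed_walk : ∀ t : N.Sink, ∀ p ∈ (σ.routed t).support, IsWalk N.tl N.hd none p (some t.1)
  total : ∀ t : N.Sink, ((σ.routed t).sum fun _ r => r) + σ.dem t = |N.b t|
  -- `balance` is silent about the super-source; this keeps a separate account of every dummy arc.
  source : ∀ s : N.Source, σ.flow (.inr s)
    + ∑ t, ((σ.routed t).sum fun p r => if (.inr s : N.Arc) ∈ p then r else 0) = N.b s
  confluent : ∀ t, ∀ a ∈ σ.used t, ∀ a' ∈ σ.used t, N.tl a ≠ none → N.tl a = N.tl a' → a = a'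
  -- This strengthening is what makes `confluent` inductive: a vertex already left by the paths of
  -- `t` is on the current trace or cannot be left again.
  dead : ∀ t, ∀ a ∈ σ.used t, N.tl a ≠ none → a ∈ σ.trace t ∨ ∀ e, N.tl e = N.tl a → σ.flow e = 0

theorem consistent_init {x : A → ℝ} (hx : N.IsTransshipment x) : (N.init x).Consistent where
  flow_nonneg := by
    rintro (a | s)
    exacts [hx.1 a, s.2.le]
  dem_nonneg t := abs_nonneg _
  balance := by
    rintro (_ | v) hv
    · exact absurd rfl hv
    have h := hx.2 v
    simp only [Finset.sum_filter, Fintype.sum_sum_type] at h ⊢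
    simp only [init, tl, hd, loc, Sum.elim_inl, Sum.elim_inr, Option.some.injEq, reduceCtorEq,
      if_false, Finset.sum_const_zero, add_zero]
    have h1 : (∑ s : N.Source, if s.1 = v then N.b s else 0) = if 0 < N.b v then N.b v else 0 :=
      sum_subtype_ite_eq _ N.b v
    have h2 : (∑ t : N.Sink, if t.1 = v then |N.b t| else 0)
        = if N.b v < 0 then |N.b v| else 0 :=
      sum_subtype_ite_eq _ (fun v => |N.b v|) v
    rw [h1, h2]
    rcases lt_trichotomy (N.b v) 0 with h3 | h3 | h3
    · rw [if_neg (not_lt.2 h3.le), if_pos h3, abs_of_neg h3]; linarith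
    · rw [h3] at h ⊢; simp only [lt_irrefl, if_false]; linarith
    · rw [if_pos h3, if_neg (not_lt.2 h3.le)]; linarith
  trace_walk t := rfl
  loc_ne t _ := by simp [loc, init]
  routed_nonneg t := le_rfl
  routed_walk := by simp [init]
  total := by simp [init]
  source := by simp [init]
  confluent := by simp [init, used]
  dead := by simp [init, used]

/-! ### Moving a single sink -/

section Move

variable (σ : N.State) (t : N.Sink) (a : N.Arc)

theorem move_flow (e : N.Arc) :
    (σ.move t a).flow e = σ.flow e - if e = a then σ.dem t else 0 := by
  by_cases h : e = a
  · subst h; simp [move]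
  · simp [move, h]

theorem move_dem (j : N.Sink) :
    (σ.move t a).dem j = if j = t ∧ N.tl a = none then 0 else σ.dem j := by
  by_cases h : j = t <;> by_cases h' : N.tl a = none <;> simp [move, h, h']

theorem move_trace (j : N.Sink) :
    (σ.move t a).trace j = if j = t then a :: σ.trace t else σ.trace j := by
  by_cases h : j = t
  · subst h; simp [move]
  · simp [move, h]

theorem move_loc (j : N.Sink) : (σ.move t a).loc j = if j = t then N.tl a else σ.loc j := by
  by_cases h : j = t <;> simp [loc, move_trace, h]

theorem move_routed (j : N.Sink) : (σ.move t a).routed j = σ.routed j +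
    if j = t ∧ N.tl a = none then Finsupp.single (a :: σ.trace t) (σ.dem t) else 0 := by
  by_cases h : j = t
  · subst h
    by_cases h' : N.tl a = none <;> simp [move, h']
  · by_cases h' : N.tl a = none <;> simp [move, h, h']

variable {σ t a}

theorem move_flow_le (hd : 0 ≤ σ.dem t) (e : N.Arc) : (σ.move t a).flow e ≤ σ.flow e := by
  rw [move_flow]; split_ifs <;> linarith

theorem used_move_subset (j : N.Sink) :
    ∀ e ∈ (σ.move t a).used j, e ∈ σ.used j ∨ (j = t ∧ e = a) := by
  rintro e (he | ⟨p, hp, he⟩)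
  · rw [move_trace] at he
    split_ifs at he with h
    · rcases List.mem_cons.1 he with rfl | he
      · exact .inr ⟨h, rfl⟩
      · exact .inl (.inl (h ▸ he))
    · exact .inl (.inl he)
  · rw [move_routed] at hp
    rcases Finset.mem_union.1 (Finsupp.support_add hp) with hp | hp
    · exact .inl (.inr ⟨p, hp, he⟩)
    · split_ifs at hp with h
      · obtain rfl := Finset.mem_singleton.1 (Finsupp.support_single_subset hp)
        rcases List.mem_cons.1 he with rfl | he
        · exact .inr ⟨h.1, rfl⟩
        · exact .inl (.inl (h.1 ▸ he))
      · simp at hp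

end Move

variable {σ : N.State} {rk : Option V → ℕ} (hrk : ∀ a : N.Arc, rk (N.tl a) < rk (N.hd a))

include hrk in
-- No arc enters the super-source, so a dummy arc can only be the first arc of a trace, and then the
-- location is the super-source. Thus the account of a source is charged once per path.
theorem Consistent.dummy_notMem_trace (hσ : σ.Consistent) {t : N.Sink} (ht : σ.loc t ≠ none)
    (s : N.Source) : .inr s ∉ σ.trace t := by
  intro h
  cases h' : σ.trace t with
  | nil => simp [h'] at h
  | cons e p =>
    have hw := hσ.trace_walk t
    have hl : σ.loc t = N.tl e := by simp [loc, h']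
    rw [h'] at hw h
    rcases List.mem_cons.1 h with rfl | h
    · exact ht hl
    · obtain ⟨q, q', rfl⟩ := List.append_of_mem h
      obtain ⟨x, hq, hx, -⟩ := isWalk_append.1 hw.2
      have hx : x = none := hx.symm
      cases hv : q using List.reverseRecOn with
      | nil => rw [hv] at hq; exact hd_ne_none e (hq.trans hx)
      | append_singleton l b =>
        rw [hv] at hq
        obtain ⟨y, -, -, hy⟩ := isWalk_append.1 hq
        exact hd_ne_none b (Eq.trans hy hx)

include hrk in
open Classical in
theorem Consistent.move (hσ : σ.Consistent) {t : N.Sink} {a : N.Arc} (ht : σ.Active t)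
    (ha : N.hd a = σ.loc t) (hle : σ.dem t ≤ σ.flow a) : (σ.move t a).Consistent where
  flow_nonneg e := by
    rw [move_flow]
    split_ifs with h
    · subst h; linarith
    · linarith [hσ.flow_nonneg e]
  dem_nonneg j := by
    rw [move_dem]
    split_ifs
    exacts [le_rfl, hσ.dem_nonneg j]
  balance v hv := by
    have h1 : ∑ j with (σ.move t a).loc j = v, (σ.move t a).dem j
        = ∑ j with σ.loc j = v, σ.dem j + ((if N.tl a = v then σ.dem t else 0)
          - if σ.loc t = v then σ.dem t else 0) := by
      rw [sum_filter, sum_filter, ← Fintype.sum_ite_eq' t (fun _ =>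
        (if N.tl a = v then σ.dem t else 0) - if σ.loc t = v then σ.dem t else 0),
        ← sum_add_distrib]
      refine sum_congr rfl fun j _ => ?_
      rw [move_loc, move_dem]
      by_cases hj : j = t
      · subst hj
        by_cases h' : N.tl a = none
        · simp [h', Ne.symm hv]
        · simp [h']
      · simp [hj]
    simp only [h1, move_flow, sum_sub_distrib, sum_filter_ite_eq]
    rw [ha]
    linarith [hσ.balance v hv]
  trace_walk j := by
    rw [move_loc, move_trace]
    split_ifs with h
    · exact ⟨rfl, ha ▸ h ▸ hσ.trace_walk t⟩
    · exact hσ.trace_walk j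
  loc_ne j hj := by
    rw [Active, move_dem] at hj
    rw [move_loc]
    split_ifs with h
    · intro h'; simp [h, h'] at hj
    · rw [if_neg fun h' => h h'.1] at hj
      exact hσ.loc_ne j hj
  routed_nonneg j := by
    rw [move_routed]
    refine add_nonneg (hσ.routed_nonneg j) ?_
    split_ifs
    exacts [Finsupp.single_nonneg.2 ht.le, le_rfl]
  routed_walk j p hp := by
    rw [move_routed] at hp
    rcases Finset.mem_union.1 (Finsupp.support_add hp) with hp | hp
    · exact hσ.routed_walk j p hp
    · split_ifs at hp with h
      · obtain rfl := Finset.mem_singleton.1 (Finsupp.support_single_subset hp)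
        exact ⟨h.2, ha ▸ h.1 ▸ hσ.trace_walk t⟩
      · simp at hp
  total j := by
    rw [move_routed, move_dem, Finsupp.sum_add_index' (by simp) (by simp), ← hσ.total j]
    split_ifs with h
    · simp [h.1]
    · simp
  source s := by
    have h1 : ∀ j, ((σ.move t a).routed j).sum (fun p r => if (.inr s : N.Arc) ∈ p then r else 0)
        = (σ.routed j).sum (fun p r => if (.inr s : N.Arc) ∈ p then r else 0)
          + if j = t then (if (.inr s : N.Arc) = a then σ.dem t else 0) else 0 := by
      intro j
      rw [move_routed, Finsupp.sum_add_index' (by simp) (by intros; split_ifs <;> simp)]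
      congr 1
      by_cases hj : j = t
      · by_cases h' : N.tl a = none
        · simp [hj, h', hσ.dummy_notMem_trace hrk (hσ.loc_ne t ht) s]
        · have : Sum.inr s ≠ a := by rintro rfl; exact h' rfl
          simp [h', this]
      · simp [hj]
    simp only [h1, sum_add_distrib, sum_ite_eq', mem_univ, if_true, move_flow]
    linarith [hσ.source s]
  confluent := by
    have key : 0 < σ.flow a → ∀ e ∈ σ.used t, N.tl a ≠ none → N.tl a ≠ N.tl e := by
      intro hpos e he hn h
      rcases hσ.dead t e he (h ▸ hn) with h' | h'
      · have h1 := (IsWalk.rank_mem hrk (hσ.trace_walk t) h').1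
        have h2 := hrk a
        rw [ha, h] at h2
        omega
      · exact hpos.ne' (h' a h)
    have hpos : 0 < σ.flow a := lt_of_lt_of_le ht hle
    intro j e he e' he' hn h
    rcases used_move_subset j e he with h1 | ⟨hj, rfl⟩ <;>
      rcases used_move_subset j e' he' with h2 | ⟨hj', rfl⟩
    · exact hσ.confluent j e h1 e' h2 hn h
    · exact absurd h.symm (key hpos e (hj' ▸ h1) (h ▸ hn))
    · exact absurd h (key hpos e' (hj ▸ h2) hn)
    · rfl
  dead j e he hn := by
    rcases used_move_subset j e he with he | ⟨rfl, rfl⟩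
    · rcases hσ.dead j e he hn with h | h
      · left; rw [move_trace]; split_ifs with h'
        · subst h'; simp [h]
        · exact h
      · right
        intro e' he'
        have : e' ≠ a := by
          rintro rfl
          exact (lt_of_lt_of_le ht hle).ne' (h e' he')
        rw [move_flow, if_neg this, h e' he', sub_zero]
    · left; simp [move_trace]

/-! ### Routing a singular digraph -/

section Digraph

omit [Fintype V] [DecidableEq V] [Fintype A] [DecidableEq A]

variable {y : N.Arc → ℝ} {a' : N.Arc}

theorem BackReach.refl : BackReach y a' (N.hd a') := Relation.ReflTransGen.refl

/-- Heads are never the super-source, so every head that is found is a funnel and the backward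
search continues across it. -/
theorem FindsSingularDigraph.tail_mem (h : FindsSingularDigraph y a') {a : N.Arc}
    (ha : a ∈ digraphArcs y a') : BackReach y a' (N.tl a) :=
  ha.2.2.tail ⟨h.funnel _ ha.2.2 (hd_ne_none a), a, ha.1, ha.2.1, rfl, rfl⟩

/-- The only arc leaving a vertex of the singular digraph belongs to the digraph. -/
theorem FindsSingularDigraph.mem_of_tail (h : FindsSingularDigraph y a') {a : N.Arc}
    (hv : BackReach y a' (N.tl a)) (hn : N.tl a ≠ none) (ha : 0 < y a) : a ∈ digraphArcs y a' := by
  rcases Relation.ReflTransGen.cases_tail hv with h' | ⟨u, hu, -, e, he, hne, rfl, h'⟩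
  · exact absurd (show a ∈ N.outArcs y (N.hd a') from ⟨ha, h'⟩) (by
      rw [show N.outArcs y (N.hd a') = ∅ from h.junction]; simp)
  · rw [h.funnel _ hv hn ⟨ha, rfl⟩ ⟨he, h'⟩]
    exact ⟨he, hne, hu⟩

theorem FindsSingularDigraph.eq_of_tail (h : FindsSingularDigraph y a') {a e : N.Arc}
    (hv : BackReach y a' (N.tl a)) (hn : N.tl a ≠ none) (ha : 0 < y a) (he : 0 < y e)
    (hae : N.tl e = N.tl a) : a = e :=
  h.funnel _ hv hn ⟨ha, rfl⟩ ⟨he, hae⟩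

end Digraph

end State

end Network

end UnsplittableTransshipment

namespace UnsplittableTransshipment

open Finset

namespace Network

variable {V A : Type*} {N : Network V A} [Fintype V] [DecidableEq V] [Fintype A] [DecidableEq A]

namespace State

variable {σ : N.State} {rk : Option V → ℕ} (hrk : ∀ a : N.Arc, rk (N.tl a) < rk (N.hd a))

section Digraph

variable {a' : N.Arc} {t : N.Sink}

open Classical in
/-- The flow on the singular digraph. -/
noncomputable def digraphFlow (y : N.Arc → ℝ) (a' a : N.Arc) : ℝ :=
  if a ∈ digraphArcs y a' then y a else 0

theorem routeDigraph_flow (F : N.Sink → (List N.Arc →₀ ℝ)) (a : N.Arc) :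
    (σ.routeDigraph a' t F).flow a = σ.flow a - digraphFlow σ.flow a' a := by
  simp only [routeDigraph, digraphFlow]
  split_ifs <;> simp

theorem Consistent.routeDigraph_dem (hσ : σ.Consistent) (F : N.Sink → (List N.Arc →₀ ℝ))
    (j : N.Sink) : (σ.routeDigraph a' t F).dem j = σ.dem j - σ.digraphDem a' t j := by
  have h := hσ.dem_nonneg j
  simp only [routeDigraph, digraphDem, Active]
  by_cases hj : j = t
  · simp [hj]
  · by_cases hb : BackReach σ.flow a' (σ.loc j)
    · rcases h.lt_or_eq with h | h
      · simp [hj, hb, h]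
      · simp [hj, hb, ← h]
    · simp [hj, hb]

theorem Consistent.digraphDem_nonneg (hσ : σ.Consistent) (ht : σ.flow a' < σ.dem t)
    (j : N.Sink) : 0 ≤ σ.digraphDem a' t j := by
  rw [digraphDem]
  split_ifs
  exacts [(sub_pos.2 ht).le, hσ.dem_nonneg j, le_rfl]

theorem active_of_digraphDem (ht : σ.Active t) {j : N.Sink} (hj : σ.digraphDem a' t j ≠ 0) :
    σ.Active j := by
  rw [digraphDem] at hj
  split_ifs at hj with h h'
  exacts [h ▸ ht, h'.1, absurd rfl hj]

/-- At a vertex that is found, all entering arcs with flow except `a'`, and the leaving arc if there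
is one and the vertex is not the super-source, belong to the digraph. At the root, ignoring `a'`
lowers the inflow by exactly the amount by which the demand of `t` is lowered. -/
theorem Consistent.digraph_balance (hσ : σ.Consistent) (ha' : FindsSingularDigraph σ.flow a')
    (ht : σ.Active t) (hloc : σ.loc t = N.hd a') (v : Option V) (hv : v ≠ none) :
    (∑ a with N.hd a = v, digraphFlow σ.flow a' a) - (∑ a with N.tl a = v, digraphFlow σ.flow a' a)
      = ∑ j with σ.loc j = v, σ.digraphDem a' t j := by
  by_cases hb : BackReach σ.flow a' v
  · have h1 : ∑ a with N.hd a = v, digraphFlow σ.flow a' a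
        = ∑ a with N.hd a = v, σ.flow a - if N.hd a' = v then σ.flow a' else 0 := by
      rw [← sum_filter_ite_eq, ← sum_sub_distrib]
      refine sum_congr rfl fun a ha => ?_
      obtain rfl := (mem_filter.1 ha).2
      simp only [digraphFlow, digraphArcs, Set.mem_ofPred_eq]
      by_cases h : a = a'
      · simp [h]
      · rcases (hσ.flow_nonneg a).lt_or_eq with h' | h'
        · simp [h, h', hb]
        · simp [h, ← h']
    have h2 : ∑ a with N.tl a = v, digraphFlow σ.flow a' a = ∑ a with N.tl a = v, σ.flow a := by
      refine sum_congr rfl fun a ha => ?_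
      obtain rfl := (mem_filter.1 ha).2
      rw [digraphFlow]
      split_ifs with h
      · rfl
      · by_contra hne
        exact h (ha'.mem_of_tail hb hv (lt_of_le_of_ne (hσ.flow_nonneg a) hne))
    have h3 : ∑ j with σ.loc j = v, σ.digraphDem a' t j
        = ∑ j with σ.loc j = v, σ.dem j - if σ.loc t = v then σ.flow a' else 0 := by
      rw [← sum_filter_ite_eq, ← sum_sub_distrib]
      refine sum_congr rfl fun j hj => ?_
      obtain rfl := (mem_filter.1 hj).2
      simp only [digraphDem, Active]
      by_cases h : j = t
      · simp [h]
      · rcases (hσ.dem_nonneg j).lt_or_eq with h' | h'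
        · simp [h, h', hb]
        · simp [h, ← h']
    rw [h1, h2, h3, hloc, ← hσ.balance v hv]
    ring
  · rw [sum_eq_zero, sum_eq_zero, sum_eq_zero, sub_zero]
    · intro j hj
      obtain rfl := (mem_filter.1 hj).2
      have h : j ≠ t := by rintro rfl; exact hb (hloc ▸ .refl)
      simp [digraphDem, h, hb]
    · intro a ha
      obtain rfl := (mem_filter.1 ha).2
      exact if_neg fun h => hb (ha'.tail_mem h)
    · intro a ha
      obtain rfl := (mem_filter.1 ha).2
      exact if_neg fun h => hb h.2.2

include hrk in
theorem Consistent.exists_decomposition (hσ : σ.Consistent)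
    (ha' : FindsSingularDigraph σ.flow a') (ht : σ.Active t) (hloc : σ.loc t = N.hd a')
    (hlt : σ.flow a' < σ.dem t) : ∃ F, σ.IsDecomposition a' t F := by
  have hmem : ∀ a, 0 < digraphFlow σ.flow a' a → a ∈ digraphArcs σ.flow a' := by
    intro a h
    by_contra h'
    simp [digraphFlow, h'] at h
  obtain ⟨F, h1, h2, h3⟩ := exists_flow_decomposition hrk (r := none) hd_ne_none σ.loc
    (digraphFlow σ.flow a') (σ.digraphDem a' t)
    (fun a => by rw [digraphFlow]; split_ifs; exacts [hσ.flow_nonneg a, le_rfl])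
    (hσ.digraphDem_nonneg hlt) (fun j hj => hσ.loc_ne j (active_of_digraphDem ht hj.ne'))
    (hσ.digraph_balance ha' ht hloc)
  refine ⟨F, fun j p hp => ⟨(h1 j p hp).1, (h1 j p hp).2.1, fun a ha =>
    hmem a ((h1 j p hp).2.2 a ha)⟩, h2, fun a ha => ?_⟩
  have h4 := h3 a
  rw [digraphFlow, if_pos ha] at h4
  convert h4

open Classical in
theorem IsDecomposition.arcFlow_eq {F : N.Sink → (List N.Arc →₀ ℝ)}
    (hF : σ.IsDecomposition a' t F) (a : N.Arc) :
    ∑ j, ((F j).sum fun p r => if a ∈ p then r else 0) = digraphFlow σ.flow a' a := by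
  rw [digraphFlow]
  split_ifs with h
  · exact hF.flow a h
  · exact sum_eq_zero fun j _ => sum_eq_zero fun p hp =>
      if_neg fun h' => h ((hF.path j p hp).2.2 a h')

theorem IsDecomposition.nonneg {F : N.Sink → (List N.Arc →₀ ℝ)}
    (hF : σ.IsDecomposition a' t F) (j : N.Sink) : 0 ≤ F j := by
  intro p
  by_cases h : p ∈ (F j).support
  · exact (hF.path j p h).1.le
  · exact (Finsupp.notMem_support_iff.1 h).ge

theorem IsDecomposition.active {F : N.Sink → (List N.Arc →₀ ℝ)}
    (hF : σ.IsDecomposition a' t F) (ht : σ.Active t) {j : N.Sink} {p : List N.Arc}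
    (hp : p ∈ (F j).support) : σ.Active j := by
  refine active_of_digraphDem (a' := a') ht ?_
  rw [← hF.demand j]
  exact (Finset.sum_pos (fun q hq => (hF.path j q hq).1) ⟨p, hp⟩).ne'

theorem mem_support_routeDigraph {F : N.Sink → (List N.Arc →₀ ℝ)} {j : N.Sink} {p : List N.Arc}
    (hp : p ∈ ((σ.routeDigraph a' t F).routed j).support) :
    p ∈ (σ.routed j).support ∨ ∃ q ∈ (F j).support, p = q ++ σ.trace j := by
  classical
  rcases Finset.mem_union.1 (Finsupp.support_add hp) with hp | hp
  · exact .inl hp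
  · obtain ⟨q, hq, rfl⟩ := Finset.mem_image.1 (Finsupp.mapDomain_support hp)
    exact .inr ⟨q, hq, rfl⟩

theorem used_routeDigraph {F : N.Sink → (List N.Arc →₀ ℝ)} {j : N.Sink} {a : N.Arc}
    (ha : a ∈ (σ.routeDigraph a' t F).used j) :
    a ∈ σ.used j ∨ ∃ q ∈ (F j).support, a ∈ q := by
  rcases ha with ha | ⟨p, hp, ha⟩
  · exact .inl (.inl ha)
  · rcases mem_support_routeDigraph hp with hp | ⟨q, hq, rfl⟩
    · exact .inl (.inr ⟨p, hp, ha⟩)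
    · rcases List.mem_append.1 ha with ha | ha
      · exact .inr ⟨q, hq, ha⟩
      · exact .inl (.inl ha)

include hrk in
open Classical in
theorem Consistent.routeDigraph (hσ : σ.Consistent) (ha' : FindsSingularDigraph σ.flow a')
    (ht : σ.Active t) (hloc : σ.loc t = N.hd a')
    {F : N.Sink → (List N.Arc →₀ ℝ)} (hF : σ.IsDecomposition a' t F) :
    (σ.routeDigraph a' t F).Consistent := by
  have hdig : ∀ {j q a}, q ∈ (F j).support → a ∈ q → a ∈ digraphArcs σ.flow a' :=
    fun hq ha => (hF.path _ _ hq).2.2 _ ha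
  -- The argument for a single move, applied to all arcs of a path: they all end at or below the
  -- location of `j` in rank.
  have hnew : ∀ {j q a}, q ∈ (F j).support → a ∈ q → N.tl a ≠ none →
      ∀ e ∈ σ.used j, N.tl a ≠ N.tl e := by
    intro j q a hq ha hn e he h
    rcases hσ.dead j e he (h ▸ hn) with h' | h'
    · have h1 := (IsWalk.rank_mem hrk (hσ.trace_walk j) h').1
      have h2 := (IsWalk.rank_mem hrk (hF.path j q hq).2.1 ha).2
      have h3 := hrk a
      rw [h] at h3
      omega
    · exact (hdig hq ha).1.ne' (h' a h)
  exact
  { flow_nonneg := fun a => by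
      rw [routeDigraph_flow, digraphFlow]
      split_ifs
      · simp
      · simpa using hσ.flow_nonneg a
    dem_nonneg := fun j => by
      simp only [State.routeDigraph]
      split_ifs
      exacts [hσ.flow_nonneg a', le_rfl, hσ.dem_nonneg j]
    balance := fun v hv => by
      simp only [routeDigraph_flow, hσ.routeDigraph_dem, sum_sub_distrib]
      have h1 := hσ.balance v hv
      have h2 := hσ.digraph_balance ha' ht hloc v hv
      change _ = ∑ j with σ.loc j = v, σ.dem j - ∑ j with σ.loc j = v, _
      linarith
    trace_walk := hσ.trace_walk
    loc_ne := fun j hj => by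
      refine hσ.loc_ne j ?_
      simp only [Active, State.routeDigraph] at hj
      split_ifs at hj with h
      exacts [h ▸ ht, absurd hj (lt_irrefl _), hj]
    routed_nonneg := fun j => add_nonneg (hσ.routed_nonneg j)
      (Finsupp.mapDomain_nonneg (hF.nonneg j))
    routed_walk := fun j p hp => by
      rcases mem_support_routeDigraph hp with hp | ⟨q, hq, rfl⟩
      · exact hσ.routed_walk j p hp
      · exact (hF.path j q hq).2.1.append (hσ.trace_walk j)
    total := fun j => by
      rw [hσ.routeDigraph_dem, ← hσ.total j, ← hF.demand j]
      simp only [State.routeDigraph]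
      rw [Finsupp.sum_add_index' (by simp) (by simp),
        Finsupp.sum_mapDomain_index (by simp) (by simp)]
      ring
    source := fun s => by
      have h1 : ∀ j, ((σ.routeDigraph a' t F).routed j).sum
          (fun p r => if (.inr s : N.Arc) ∈ p then r else 0)
          = (σ.routed j).sum (fun p r => if (.inr s : N.Arc) ∈ p then r else 0)
            + (F j).sum (fun p r => if (.inr s : N.Arc) ∈ p then r else 0) := by
        intro j
        simp only [State.routeDigraph]
        rw [Finsupp.sum_add_index' (by simp) (by intros; split_ifs <;> simp),
          Finsupp.sum_mapDomain_index (by simp) (by intros; split_ifs <;> simp)]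
        congr 1
        refine Finsupp.sum_congr fun p hp => ?_
        simp [hσ.dummy_notMem_trace hrk (hσ.loc_ne j (hF.active ht hp)) s]
      simp only [h1, sum_add_distrib, hF.arcFlow_eq, routeDigraph_flow]
      linarith [hσ.source s]
    confluent := by
      intro j a ha e he hn h
      rcases used_routeDigraph ha with h1 | ⟨q, hq, h1⟩ <;>
        rcases used_routeDigraph he with h2 | ⟨q', hq', h2⟩
      · exact hσ.confluent j a h1 e h2 hn h
      · exact absurd h.symm (hnew hq' h2 (h ▸ hn) a h1)
      · exact absurd h (hnew hq h1 hn e h2)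
      · exact ha'.eq_of_tail (ha'.tail_mem (hdig hq h1)) hn (hdig hq h1).1 (hdig hq' h2).1 h.symm
    dead := by
      intro j a ha hn
      rcases used_routeDigraph ha with h1 | ⟨q, hq, h1⟩
      · refine (hσ.dead j a h1 hn).imp_right fun h e he => ?_
        simp [State.routeDigraph, h e he]
      · right
        intro e he
        have ha := hdig hq h1
        simp only [State.routeDigraph, ite_eq_left_iff]
        intro hne
        by_contra h0
        obtain rfl := ha'.eq_of_tail (ha'.tail_mem ha) hn ha.1
          (lt_of_le_of_ne (hσ.flow_nonneg e) (Ne.symm h0)) he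
        exact hne ha }

end Digraph

/-! ### Augmentation along alternating cycles -/

section Augment

variable {C : List (TrailStep N)}

theorem sum_src_add_tgt (g : Option V → ℝ) (s : TrailStep N) (l : List (TrailStep N))
    (h : (s :: l).IsChain fun e f => e.tgt = f.src) :
    ((s :: l).map fun e => g e.src).sum + g ((s :: l).getLast (by simp)).tgt
      = ((s :: l).map fun e => g e.tgt).sum + g s.src := by
  induction l generalizing s with
  | nil => simp [add_comm]
  | cons s' l ih =>
    have h' := ih s' h.of_cons
    have h1 : g s.tgt = g s'.src := congrArg g (List.isChain_cons_cons.1 h).1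
    rw [List.getLast_cons (List.cons_ne_nil _ _)]
    simp only [List.map_cons, List.sum_cons] at h' ⊢
    linarith

theorem FindsCycle.chain {y : N.Arc → ℝ} (hC : FindsCycle y C) :
    C.IsChain (TrailStep.Next y) := by
  obtain ⟨l, hl, -⟩ := hC.trail
  exact (List.isChain_append.1 hl.chain).2.1

theorem FindsCycle.nodup {y : N.Arc → ℝ} (hC : FindsCycle y C) :
    (C.map TrailStep.src).Nodup := by
  obtain ⟨l, -, hl⟩ := hC.trail
  rw [List.map_append] at hl
  exact hl.of_append_right

/-- Along a closed trail every vertex is left as often as it is entered. The choices of `g` below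
are the rank, the indicator of the super-source, and `ε` times the indicator of a vertex. -/
theorem FindsCycle.sum_src_eq {y : N.Arc → ℝ} (hC : FindsCycle y C) (g : Option V → ℝ) :
    (C.map fun e => g e.src).sum = (C.map fun e => g e.tgt).sum := by
  have h := hC.closed
  cases C with
  | nil => rfl
  | cons s l =>
    have h1 := sum_src_add_tgt g s l (hC.chain.imp fun _ _ h => h.1)
    rw [List.getLast?_eq_getLast_of_ne_nil (by simp)] at h
    simp only [Option.map_some, List.head?_cons, Option.some.injEq] at h
    rw [h] at h1
    linarith

theorem FindsCycle.pos {y : N.Arc → ℝ} (hC : FindsCycle y C) : ∀ e ∈ C, 0 < y e.arc := by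
  obtain ⟨l, hl, -⟩ := hC.trail
  exact fun e he => hl.pos e (by simp [he])

theorem FindsCycle.singular {y : N.Arc → ℝ} (hC : FindsCycle y C) :
    ∀ e ∈ C, e.forward = false → N.IsSingular y e.arc := by
  obtain ⟨l, hl, -⟩ := hC.trail
  exact fun e he => hl.singular e (by simp [he])

/-- The last and first steps are an exception: closing the cycle only requires their vertices to
match. -/
theorem FindsCycle.exists_next {y : N.Arc → ℝ} (hC : FindsCycle y C) :
    ∀ e ∈ C, ∃ f ∈ C, f.src = e.tgt ∧
      (e.arc ≠ f.arc ∨ C.getLast? = some e ∧ C.head? = some f) := by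
  intro e he
  obtain ⟨l, l', rfl⟩ := List.append_of_mem he
  cases l' with
  | cons f l' =>
    have h := (List.isChain_cons_cons.1 (List.isChain_append.1 hC.chain).2.1).1
    exact ⟨f, by simp, h.1.symm, .inl h.2.1⟩
  | nil =>
    have hcl := hC.closed
    obtain ⟨f, hf⟩ : ∃ f, (l ++ [e]).head? = some f := by cases l <;> simp
    rw [List.getLast?_concat, hf] at hcl
    exact ⟨f, List.mem_of_head? hf, by simpa using hcl.symm, .inr ⟨List.getLast?_concat, hf⟩⟩

theorem FindsCycle.eq_of_src_eq {y : N.Arc → ℝ} (hC : FindsCycle y C) {e f : TrailStep N}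
    (he : e ∈ C) (hf : f ∈ C) (h : e.src = f.src) : e = f :=
  List.inj_on_of_nodup_map hC.nodup he hf h

/-- No arc is traversed in both directions. -/
theorem FindsCycle.disjoint {y : N.Arc → ℝ} (hC : FindsCycle y C) {a : N.Arc}
    (h : a ∈ cycleArcs C true) (h' : a ∈ cycleArcs C false) : False := by
  -- The two traversals of `a` would have to succeed each other in both orders. Consecutive steps
  -- use different arcs except at the closing point, and only one of the two can be the last step.
  obtain ⟨f, hf, hfs, h1⟩ := hC.exists_next _ h
  obtain ⟨g, hg, hgs, h2⟩ := hC.exists_next _ h'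
  obtain rfl := hC.eq_of_src_eq hf h' hfs
  obtain rfl := hC.eq_of_src_eq hg h hgs
  have h1 := h1.resolve_left (by simp)
  have h2 := h2.resolve_left (by simp)
  simpa using h1.1.symm.trans h2.1

/-- A nice alternating cycle has a forward arc. -/
theorem FindsCycle.exists_forward (hrk : ∀ a : N.Arc, rk (N.tl a) < rk (N.hd a))
    {y : N.Arc → ℝ} (hC : FindsCycle y C) : ∃ a, a ∈ cycleArcs C true := by
  by_contra! hne
  have hb : ∀ e ∈ C, rk e.tgt < rk e.src := by
    rintro ⟨a, f⟩ he
    cases f with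
    | true => exact absurd he (hne a)
    | false => exact hrk a
  have h := hC.sum_src_eq fun v => (rk v : ℝ)
  refine absurd h (ne_of_gt (List.sum_lt_sum_of_ne_nil hC.nonempty _ _ fun e he => ?_))
  exact_mod_cast hb e he

/-- No step ends at the super-source, hence by counting none starts there. So dummy arcs are never
augmented. -/
theorem FindsCycle.ne_none {y : N.Arc → ℝ} (hC : FindsCycle y C) {e : TrailStep N} (he : e ∈ C) :
    N.tl e.arc ≠ none := by
  obtain ⟨l, hl, -⟩ := hC.trail
  have htgt : ∀ e ∈ C, e.tgt ≠ none := fun e he => hl.ne_super e (by simp [he])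
  have h := hC.sum_src_eq fun v => if v = none then (1 : ℝ) else 0
  rw [List.sum_eq_zero (l := C.map fun e => if e.tgt = none then (1 : ℝ) else 0)] at h
  · rcases e with ⟨a, f⟩
    cases f with
    | false => exact htgt _ he
    | true =>
      intro h'
      have := List.single_le_sum (l := C.map fun e => if e.src = none then (1 : ℝ) else 0)
        (by simp only [List.mem_map]; rintro _ ⟨e, -, rfl⟩; split_ifs <;> norm_num) 1
        (List.mem_map.2 ⟨_, he, if_pos h'⟩)
      linarith
  · simp only [List.mem_map]
    rintro _ ⟨e, he, rfl⟩
    exact if_neg (htgt e he)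

open Classical in
-- Turns a sum over arcs into a sum over steps, to which the cyclic telescoping applies.
theorem sum_cycleArcs (hC : C.Nodup) (G : N.Arc → ℝ) (ε : ℝ) :
    ∑ a, G a * ((if a ∈ cycleArcs C false then ε else 0) - if a ∈ cycleArcs C true then ε else 0)
      = (C.map fun e => if e.forward then -(G e.arc * ε) else G e.arc * ε).sum := by
  induction C with
  | nil => simp [cycleArcs]
  | cons e C ih =>
    have hC := List.nodup_cons.1 hC
    have key : ∀ a b, (if a ∈ cycleArcs (e :: C) b then ε else 0)
        = (if (⟨a, b⟩ : TrailStep N) = e then ε else 0) + if a ∈ cycleArcs C b then ε else 0 := by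
      intro a b
      have h1 : a ∈ cycleArcs (e :: C) b ↔ (⟨a, b⟩ : TrailStep N) = e ∨ a ∈ cycleArcs C b :=
        List.mem_cons
      by_cases h : (⟨a, b⟩ : TrailStep N) = e
      · have h2 : a ∉ cycleArcs C b := fun h' => hC.1 (h ▸ h')
        simp [h1, h, h2]
      · simp [h1, h]
    rw [List.map_cons, List.sum_cons, ← ih hC.2]
    simp only [key]
    rw [show (if e.forward then -(G e.arc * ε) else G e.arc * ε) = ∑ a, G a *
      ((if (⟨a, false⟩ : TrailStep N) = e then ε else 0)
        - if (⟨a, true⟩ : TrailStep N) = e then ε else 0) from ?_, ← sum_add_distrib]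
    · exact sum_congr rfl fun a _ => by ring
    · rcases e with ⟨a, f⟩
      cases f <;> simp

theorem FindsCycle.augment_balance {y : N.Arc → ℝ} (hC : FindsCycle y C) (σ : N.State) (ε : ℝ)
    (v : Option V) :
    (∑ a with N.hd a = v, (σ.augment C ε).flow a) - (∑ a with N.tl a = v, (σ.augment C ε).flow a)
      = (∑ a with N.hd a = v, σ.flow a) - ∑ a with N.tl a = v, σ.flow a := by
  classical
  -- The weight of an arc is its contribution to the net inflow at `v`.
  have h1 := sum_cycleArcs hC.nodup.of_map
    (fun a => (if N.hd a = v then 1 else 0) - if N.tl a = v then 1 else 0) ε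
  have h2 := hC.sum_src_eq fun u => (if u = v then ε else 0)
  have h3 : (C.map fun e : TrailStep N =>
      if e.forward then -(((if N.hd e.arc = v then 1 else 0) - if N.tl e.arc = v then 1 else 0) * ε)
        else ((if N.hd e.arc = v then 1 else 0) - if N.tl e.arc = v then 1 else 0) * ε).sum
      = (C.map fun e => if e.src = v then ε else 0).sum
        - (C.map fun e => if e.tgt = v then ε else 0).sum := by
    rw [eq_sub_iff_add_eq, ← List.sum_map_add]
    congr 1
    refine List.map_congr_left fun e _ => ?_
    rcases e with ⟨a, f⟩
    cases f <;> simp [TrailStep.src, TrailStep.tgt, sub_mul]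
  rw [h3, h2, sub_self] at h1
  simp only [sum_filter, ← sum_sub_distrib]
  refine sub_eq_zero.1 (Eq.trans ?_ h1)
  rw [← sum_sub_distrib]
  refine sum_congr rfl fun a _ => ?_
  simp only [augment]
  split_ifs <;> ring

theorem augment_flow_of_notMem {a : N.Arc} (h : ∀ e ∈ C, e.arc ≠ a) (ε : ℝ) :
    (σ.augment C ε).flow a = σ.flow a := by
  have : ∀ b, a ∉ cycleArcs C b := fun b hb => h _ hb rfl
  simp [augment, this]

theorem FindsCycle.augment_flow_forward {y : N.Arc → ℝ} (hC : FindsCycle y C) {a : N.Arc}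
    (h : a ∈ cycleArcs C true) (ε : ℝ) : (σ.augment C ε).flow a = σ.flow a - ε := by
  have h' : a ∉ cycleArcs C false := fun h' => hC.disjoint h h'
  simp [augment, h, h']

theorem FindsCycle.augment_flow_backward {y : N.Arc → ℝ} (hC : FindsCycle y C) {a : N.Arc}
    (h : a ∈ cycleArcs C false) (ε : ℝ) : (σ.augment C ε).flow a = σ.flow a + ε := by
  have h' : a ∉ cycleArcs C true := fun h' => hC.disjoint h' h
  simp [augment, h, h']

theorem cycleArcs_cases (C : List (TrailStep N)) (a : N.Arc) :
    a ∈ cycleArcs C true ∨ a ∈ cycleArcs C false ∨ ∀ e ∈ C, e.arc ≠ a := by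
  by_contra! h
  obtain ⟨h1, h2, ⟨a, f⟩, h3, rfl⟩ := h
  cases f
  exacts [h2 h3, h1 h3]

theorem Consistent.augment (hσ : σ.Consistent) (hC : FindsCycle σ.flow C) {ε : ℝ}
    (hε : ε ∈ lowerBounds (σ.augmentBounds C)) (hε₀ : 0 ≤ ε) : (σ.augment C ε).Consistent where
  flow_nonneg a := by
    rcases cycleArcs_cases C a with h | h | h
    · rw [hC.augment_flow_forward h]
      exact sub_nonneg.2 (hε (.inl ⟨a, h, rfl⟩))
    · rw [hC.augment_flow_backward h]
      exact add_nonneg (hσ.flow_nonneg a) hε₀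
    · rw [augment_flow_of_notMem h]
      exact hσ.flow_nonneg a
  dem_nonneg := hσ.dem_nonneg
  balance v hv := (hC.augment_balance σ ε v).trans (hσ.balance v hv)
  trace_walk := hσ.trace_walk
  loc_ne := hσ.loc_ne
  routed_nonneg := hσ.routed_nonneg
  routed_walk := hσ.routed_walk
  total := hσ.total
  source s := by
    rw [augment_flow_of_notMem]
    · exact hσ.source s
    · intro e he h
      exact hC.ne_none he (h ▸ rfl)
  confluent := hσ.confluent
  dead t a ha hn := (hσ.dead t a ha hn).imp_right fun h e he => by
    rw [augment_flow_of_notMem, h e he]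
    rintro f hf rfl
    exact (hC.pos f hf).ne' (h _ he)

end Augment

end State

end Network

end UnsplittableTransshipment

namespace UnsplittableTransshipment

open Finset

/-! ### Singular vertices and junctions -/

namespace Network

variable {V A : Type*} {N : Network V A} [Fintype V] [DecidableEq V] [Fintype A] [DecidableEq A]

/-- All vertices reachable from `v` have out-degree at most one. -/
def SingularVertex (y : N.Arc → ℝ) (v : Option V) : Prop := ∀ u, N.Reach y v u → N.IsFunnel y u

theorem SingularVertex.head {y : N.Arc → ℝ} {a : N.Arc} (h : SingularVertex y (N.tl a))
    (ha : 0 < y a) : SingularVertex y (N.hd a) :=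
  fun u hu => h u (.head ⟨a, ha, rfl, rfl⟩ hu)

/-- The arc `a` is the only way out of its tail, so anything else reachable is reached through its
head. -/
theorem SingularVertex.of_head {y : N.Arc → ℝ} {a : N.Arc} (h : SingularVertex y (N.hd a))
    (ha : 0 < y a) (hf : N.IsFunnel y (N.tl a)) : SingularVertex y (N.tl a) := by
  intro u hu
  rcases Relation.ReflTransGen.cases_head hu with rfl | ⟨v, ⟨e, he, het, rfl⟩, hv⟩
  · exact hf
  · obtain rfl : e = a := hf ⟨he, het⟩ ⟨ha, rfl⟩
    exact h u hv

theorem IsJunction.mono {y y' : N.Arc → ℝ} {v : Option V} (h : N.IsJunction y v)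
    (hy : ∀ a, 0 < y' a → 0 < y a) : N.IsJunction y' v :=
  Set.subset_empty_iff.1 fun a ha => h ▸ (⟨hy a ha.1, ha.2⟩ : a ∈ N.outArcs y v)

namespace State

variable {σ : N.State} {rk : Option V → ℕ} (hrk : ∀ a : N.Arc, rk (N.tl a) < rk (N.hd a))

/-! ### Irregular sinks -/

/-- The demand of the (sub-)sink of `t` is less than the flow on some arc entering its location. -/
def Irregular (σ : N.State) (t : N.Sink) : Prop :=
  σ.Active t ∧ ∃ a, N.hd a = σ.loc t ∧ σ.dem t < σ.flow a

/-- Among the vertices in `S`, irregular sinks are located only at junctions, and at most one at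
each of them. -/
structure Tame (S : Option V → Prop) (σ : N.State) : Prop where
  junction : ∀ t, σ.Irregular t → S (σ.loc t) → N.IsJunction σ.flow (σ.loc t)
  unique : ∀ t t', σ.Irregular t → σ.Irregular t' → S (σ.loc t) → σ.loc t = σ.loc t' → t = t'

/-- A move into `S` uses up the only arc leaving the new location, which thereby becomes a junction.
No other irregular sink can be there already: before the move this vertex was not a junction. -/
theorem Tame.move {S : Option V → Prop} (hT : σ.Tame S) {t : N.Sink} {a : N.Arc}
    (hd : 0 ≤ σ.dem t) (ha : 0 < σ.flow a)
    (hS : S (N.tl a) → σ.flow a = σ.dem t ∧ N.IsFunnel σ.flow (N.tl a)) :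
    (σ.move t a).Tame S := by
  have hle := move_flow_le (σ := σ) (t := t) (a := a) hd
  have hpos : ∀ e, 0 < (σ.move t a).flow e → 0 < σ.flow e := fun e he => he.trans_le (hle e)
  have hold : ∀ j, j ≠ t → (σ.move t a).Irregular j → σ.Irregular j := by
    rintro j hj ⟨h1, e, he, h2⟩
    rw [Active, move_dem, if_neg fun h => hj h.1] at h1
    rw [move_dem, if_neg fun h => hj h.1] at h2
    rw [move_loc, if_neg hj] at he
    exact ⟨h1, e, he, h2.trans_le (hle e)⟩
  have hnot : ∀ j, j ≠ t → σ.Irregular j → S (N.tl a) → σ.loc j ≠ N.tl a := by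
    intro j hj hi hs h
    have hjn := hT.junction j hi (h ▸ hs)
    have : a ∈ N.outArcs σ.flow (σ.loc j) := ⟨ha, h.symm⟩
    rw [hjn] at this
    exact this
  constructor
  · intro j hj hs
    rw [move_loc] at hs ⊢
    split_ifs at hs ⊢ with h
    · refine Set.eq_empty_of_forall_notMem fun e he => ?_
      obtain rfl := (hS hs).2 ⟨hpos e he.1, he.2⟩ ⟨ha, rfl⟩
      have := he.1
      rw [move_flow, if_pos rfl, (hS hs).1] at this
      simp at this
    · exact (hT.junction j (hold j h hj) hs).mono hpos
  · intro j j' hj hj' hs h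
    rw [move_loc] at hs h
    rw [move_loc] at h
    split_ifs at hs h with h1 h2 h2
    · rw [h1, h2]
    · exact absurd h.symm (hnot j' h2 (hold j' h2 hj') hs)
    · exact absurd h (hnot j h1 (hold j h1 hj) (h ▸ hs))
    · exact hT.unique j j' (hold j h1 hj) (hold j' h2 hj') hs h

/-- No sink becomes irregular. Of the arcs entering the root only `a'` keeps flow, and this flow
equals the new demand of `t`. -/
theorem Tame.routeDigraph {S : Option V → Prop} (hT : σ.Tame S) (hσ : σ.Consistent) {a' : N.Arc}
    {t : N.Sink} (hloc : σ.loc t = N.hd a')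
    (F : N.Sink → (List N.Arc →₀ ℝ)) : (σ.routeDigraph a' t F).Tame S := by
  have hle : ∀ e, (σ.routeDigraph a' t F).flow e ≤ σ.flow e := by
    intro e
    simp only [State.routeDigraph]
    split_ifs
    exacts [hσ.flow_nonneg e, le_rfl]
  have hold : ∀ j, (σ.routeDigraph a' t F).Irregular j → σ.Irregular j := by
    rintro j ⟨h1, e, he, h2⟩
    by_cases hj : j = t
    · subst hj
      exfalso
      have he : N.hd e = N.hd a' := Eq.trans he hloc
      have h3 := hσ.flow_nonneg e
      have h4 := hσ.flow_nonneg a'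
      simp only [State.routeDigraph, if_true] at h2
      split_ifs at h2 with h
      · linarith
      · by_cases hea : e = a'
        · subst hea; exact lt_irrefl _ h2
        · exact h ⟨by linarith, hea, he ▸ .refl⟩
    · simp only [Active, State.routeDigraph, if_neg hj] at h1 h2
      split_ifs at h1 h2
      · exact absurd h1 (lt_irrefl _)
      · exact absurd h1 (lt_irrefl _)
      · exact absurd h2 (by linarith)
      · exact ⟨h1, e, he, h2⟩
  constructor
  · intro j hj hs
    exact (hT.junction j (hold j hj) hs).mono fun e he => he.trans_le (hle e)
  · intro j j' hj hj' hs h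
    exact hT.unique j j' (hold j hj) (hold j' hj') hs h

theorem FindsCycle.augment_pos {C : List (TrailStep N)} (hC : FindsCycle σ.flow C) {ε : ℝ}
    {a : N.Arc} (h : 0 < (σ.augment C ε).flow a) : 0 < σ.flow a := by
  by_cases h' : ∃ e ∈ C, e.arc = a
  · obtain ⟨e, he, rfl⟩ := h'
    exact hC.pos e he
  · push Not at h'
    rwa [augment_flow_of_notMem h'] at h

/-- Flow grows only on backward arcs, and there the bound on `ε` keeps it from exceeding a demand
that was larger before. As ties are excluded by `hne`, every irregular sink was irregular before. -/
theorem Tame.augment (hT : σ.Tame fun _ => True)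
    (hne : ∀ t a, σ.Active t → N.hd a = σ.loc t → σ.flow a ≠ σ.dem t)
    {C : List (TrailStep N)} (hC : FindsCycle σ.flow C) {ε : ℝ}
    (hε : ε ∈ lowerBounds (σ.augmentBounds C)) (hε₀ : 0 ≤ ε) :
    (σ.augment C ε).Tame fun _ => True := by
  have hold : ∀ j, (σ.augment C ε).Irregular j → σ.Irregular j := by
    rintro j ⟨h1, e, he, h2⟩
    refine ⟨h1, e, he, lt_of_le_of_ne (not_lt.1 fun h3 => ?_) (hne j e h1 he).symm⟩
    refine absurd h2 (not_lt.2 ?_)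
    change _ ≤ σ.dem j
    rcases cycleArcs_cases C e with h | h | h
    · rw [hC.augment_flow_forward h]
      linarith
    · rw [hC.augment_flow_backward h]
      have := hε (.inr ⟨e, h, j, h1, he.symm, h3, rfl⟩)
      linarith
    · rw [augment_flow_of_notMem h]
      exact h3.le
  constructor
  · intro j hj hs
    exact (hT.junction j (hold j hj) hs).mono fun e he => hC.augment_pos he
  · intro j j' hj hj' hs h
    exact hT.unique j j' (hold j hj) (hold j' hj') hs h

theorem Tame.mono {S S' : Option V → Prop} (hT : σ.Tame S) (h : ∀ v, S' v → S v) : σ.Tame S' :=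
  ⟨fun t ht hs => hT.junction t ht (h _ hs), fun t t' ht ht' hs => hT.unique t t' ht ht' (h _ hs)⟩

/-! ### The search never fails -/

/-- A step of the alternating search that can be continued. -/
structure TrailStep.Extendable (y : N.Arc → ℝ) (e : TrailStep N) : Prop where
  pos : 0 < y e.arc
  singular : e.forward = false → N.IsSingular y e.arc
  back : e.forward = false → ∃ v, v ≠ none ∧ ¬ N.IsFunnel y v ∧
    Relation.ReflTransGen
      (fun u v => N.IsFunnel y u ∧ ∃ a, 0 < y a ∧ N.hd a = u ∧ N.tl a = v) e.tgt v

include hrk in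
theorem arc_ne_of_tl_eq_hd {a e : N.Arc} (h : N.tl a = N.hd e) : e ≠ a := by
  rintro rfl
  have := hrk e
  rw [h] at this
  exact lt_irrefl _ this

theorem TrailStep.Extendable.tgt_ne_none {y : N.Arc → ℝ} {e : TrailStep N}
    (he : e.Extendable y) : e.tgt ≠ none := by
  rcases e with ⟨a, f⟩
  cases f with
  | true => exact hd_ne_none a
  | false =>
    obtain ⟨v, hv, -, h⟩ := he.back rfl
    rcases Relation.ReflTransGen.cases_head h with h | ⟨u, ⟨-, e, -, h, -⟩, -⟩
    · exact h ▸ hv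
    · exact h ▸ hd_ne_none e

include hrk in
theorem TrailStep.Extendable.exists_next {y : N.Arc → ℝ}
    (hy : ∀ a', ¬ FindsSingularDigraph y a') {e : TrailStep N} (he : e.Extendable y) :
    ∃ f : TrailStep N, f.Extendable y ∧ TrailStep.Next y e f := by
  rcases e with ⟨a, f⟩
  cases f with
  | true =>
    by_cases hj : N.IsJunction y (N.hd a)
    -- The absence of singular digraphs supplies a non-funnel vertex to aim at; carrying it along
    -- keeps the search away from the super-source.
    · obtain ⟨v, hv, hn, hf⟩ : ∃ v, BackReach y a v ∧ v ≠ none ∧ ¬ N.IsFunnel y v := by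
        by_contra! h
        exact hy a ⟨he.pos, hj, h⟩
      have hfun : N.IsFunnel y (N.hd a) := by
        rw [IsFunnel, show N.outArcs y (N.hd a) = ∅ from hj]
        exact Set.subsingleton_empty
      rcases Relation.ReflTransGen.cases_head hv with rfl | ⟨u, ⟨-, e, hpe, hne, heh, rfl⟩, hu⟩
      · exact absurd hfun hf
      · refine ⟨⟨e, false⟩, ⟨hpe, fun _ => ⟨hpe, fun u hu' => ?_⟩, fun _ => ⟨v, hn, hf, ?_⟩⟩,
          heh.symm, hne.symm, fun _ _ => hj, fun h => by simp at h⟩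
        · rw [heh] at hu'
          rcases Relation.ReflTransGen.cases_head hu' with rfl | ⟨x, ⟨b, hb, hbt, -⟩, -⟩
          · exact hfun
          · have : b ∈ N.outArcs y (N.hd a) := ⟨hb, hbt⟩
            rw [hj] at this
            exact absurd this (Set.notMem_empty _)
        -- The ban on `a` was needed only to choose `e`; it is dropped from here on.
        · refine Relation.ReflTransGen.mono ?_ _ _ hu
          rintro x z ⟨h1, b, h2, -, h3⟩
          exact ⟨h1, b, h2, h3⟩
    · obtain ⟨b, hb, hbt⟩ := Set.nonempty_iff_ne_empty.2 hj
      exact ⟨⟨b, true⟩, ⟨hb, fun h => by simp at h, fun h => by simp at h⟩, hbt.symm,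
        arc_ne_of_tl_eq_hd hrk hbt, fun _ h => by simp at h, fun h => by simp at h⟩
  | false =>
    obtain ⟨v, hn, hf, hv⟩ := he.back rfl
    rcases Relation.ReflTransGen.cases_head hv with rfl | ⟨u, ⟨hfun, b, hpb, hbh, rfl⟩, hu⟩
    · obtain ⟨b, hb, hba⟩ := (Set.not_subsingleton_iff.1 hf).exists_ne a
      exact ⟨⟨b, true⟩, ⟨hb.1, fun h => by simp at h, fun h => by simp at h⟩, hb.2.symm,
        hba.symm, fun h => by simp at h, fun _ _ => hf⟩
    · refine ⟨⟨b, false⟩, ⟨hpb, fun _ => ⟨hpb, ?_⟩, fun _ => ⟨v, hn, hf, hu⟩⟩, hbh.symm,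
        (arc_ne_of_tl_eq_hd hrk hbh.symm).symm, fun h => by simp at h, fun _ h => by simp at h⟩
      have : SingularVertex y (N.tl a) := SingularVertex.of_head (he.singular rfl).2 he.pos hfun
      rwa [show N.hd b = N.tl a from hbh]

include hrk in
-- Extend the search forever. As there are finitely many vertices, one recurs; cutting at the first
-- recurrence makes all earlier vertices distinct.
theorem exists_cycle {y : N.Arc → ℝ} (hy : ∀ a', ¬ FindsSingularDigraph y a')
    (hpos : ∃ a, 0 < y a) : ∃ C, FindsCycle y C := by
  obtain ⟨a₀, ha₀⟩ := hpos
  choose next hnext using fun e : {e : TrailStep N // e.Extendable y} =>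
    TrailStep.Extendable.exists_next hrk hy e.2
  let s : ℕ → {e : TrailStep N // e.Extendable y} := fun n => Nat.rec
    ⟨⟨a₀, true⟩, ha₀, fun h => by simp at h, fun h => by simp at h⟩
    (fun _ e => ⟨next e, (hnext e).1⟩) n
  have hs : ∀ n, TrailStep.Next y (s n).1 (s (n + 1)).1 := fun n => (hnext (s n)).2
  have hrep : ∃ n, ∃ m < n, (s m).1.src = (s n).1.src := by
    obtain ⟨i, j, hij, h⟩ := Finite.exists_ne_map_eq_of_infinite fun n => (s n).1.src
    rcases hij.lt_or_gt with h' | h'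
    exacts [⟨j, i, h', h⟩, ⟨i, j, h', h.symm⟩]
  classical
  obtain ⟨m, hmn, hm⟩ := Nat.find_spec hrep
  have hmin : ∀ k < Nat.find hrep, ∀ i < k, (s i).1.src ≠ (s k).1.src := fun k hk i hi h =>
    Nat.find_min hrep hk ⟨i, hi, h⟩
  set n := Nat.find hrep
  let L : List (TrailStep N) := (List.range n).map fun i => (s i).1
  have hL : L.take m ++ L.drop m = L := List.take_append_drop m L
  have hlen : L.length = n := by simp [L]
  have hget : ∀ i (hi : i < L.length), L[i] = (s i).1 := fun i hi => by simp [L]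
  refine ⟨L.drop m, ⟨?_, ⟨L.take m, ?_, ?_⟩, ?_⟩⟩
  · exact List.ne_nil_of_length_pos (by rw [List.length_drop]; omega)
  · rw [hL]
    have hmem : ∀ e ∈ L, e.Extendable y := by
      simp only [L, List.mem_map]
      rintro _ ⟨i, -, rfl⟩
      exact (s i).2
    refine ⟨List.isChain_iff_getElem.2 fun i hi => ?_, ?_, fun e he => (hmem e he).pos,
      fun e he => (hmem e he).singular, fun e he => (hmem e he).tgt_ne_none⟩
    · rw [hget, hget]
      exact hs i
    · intro e he
      rw [List.head?_eq_getElem?, List.getElem?_eq_getElem (by omega), hget] at he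
      obtain rfl := Option.some.inj he
      rfl
  · rw [hL, List.map_map]
    refine List.Nodup.map_on ?_ List.nodup_range
    intro i hi j hj h
    rw [List.mem_range] at hi hj
    rcases lt_trichotomy i j with h' | h' | h'
    · exact absurd h (hmin j hj i h')
    · exact h'
    · exact absurd h.symm (hmin i hi j h')
  · have h := (hs (n - 1)).1
    rw [Nat.sub_add_cancel (by omega)] at h
    rw [List.getLast?_drop, if_neg (by omega), List.getLast?_eq_getElem?, hlen,
      List.getElem?_eq_getElem (by omega), hget, List.head?_drop,
      List.getElem?_eq_getElem (by omega), hget, Option.map_some, Option.map_some, hm, h]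

/-- There are finitely many bounds, and a forward arc contributes at least one. -/
theorem FindsCycle.exists_isLeast {C : List (TrailStep N)}
    (hrk : ∀ a : N.Arc, rk (N.tl a) < rk (N.hd a))
    (hC : FindsCycle σ.flow C) : ∃ ε, IsLeast (σ.augmentBounds C) ε := by
  have hfin : (σ.augmentBounds C).Finite := by
    refine ((Set.finite_range σ.flow).union
      (Set.finite_range fun p : N.Sink × N.Arc => σ.dem p.1 - σ.flow p.2)).subset ?_
    rintro r (⟨a, -, rfl⟩ | ⟨a, -, t, -, -, -, rfl⟩)
    exacts [.inl ⟨a, rfl⟩, .inr ⟨(t, a), rfl⟩]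
  obtain ⟨a, ha⟩ := hC.exists_forward hrk
  obtain ⟨ε, h1, h2⟩ := Set.exists_min_image _ id hfin ⟨_, .inl ⟨a, ha, rfl⟩⟩
  exact ⟨ε, h1, fun r hr => h2 r hr⟩

theorem FindsCycle.isLeast_pos {C : List (TrailStep N)} (hC : FindsCycle σ.flow C) {ε : ℝ}
    (hε : IsLeast (σ.augmentBounds C) ε) : 0 < ε := by
  rcases hε.1 with ⟨a, ha, rfl⟩ | ⟨a, -, t, -, -, h, rfl⟩
  exacts [hC.pos _ ha, sub_pos.2 h]

/-- At a junction, some (sub-)sink has more demand than a given incoming arc has flow. -/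
theorem Tame.exists_large_sink (hT : σ.Tame fun _ => True) (hσ : σ.Consistent)
    (hne : ∀ t a, σ.Active t → N.hd a = σ.loc t → σ.flow a ≠ σ.dem t) {a' : N.Arc}
    (ha' : 0 < σ.flow a') (hj : N.IsJunction σ.flow (N.hd a')) :
    ∃ t, σ.Active t ∧ σ.loc t = N.hd a' ∧ σ.flow a' < σ.dem t := by
  by_contra! h
  have hirr : ∀ t, σ.Active t → σ.loc t = N.hd a' → σ.Irregular t := fun t ht hl =>
    ⟨ht, a', hl.symm, lt_of_le_of_ne (h t ht hl) (hne t a' ht hl.symm).symm⟩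
  have hout : ∑ a with N.tl a = N.hd a', σ.flow a = 0 := by
    refine sum_eq_zero fun a ha => le_antisymm (not_lt.1 fun hp => ?_) (hσ.flow_nonneg a)
    have : a ∈ N.outArcs σ.flow (N.hd a') := ⟨hp, (mem_filter.1 ha).2⟩
    rw [hj] at this
    exact this
  have hin : σ.flow a' ≤ ∑ a with N.hd a = N.hd a', σ.flow a :=
    single_le_sum (fun a _ => hσ.flow_nonneg a) (by simp)
  have hbal := hσ.balance _ (hd_ne_none a')
  obtain ⟨t, ht, hpos⟩ := exists_lt_of_sum_lt (s := {t | σ.loc t = N.hd a'})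
    (f := fun _ => (0 : ℝ)) (g := σ.dem) (by rw [sum_const_zero]; linarith)
  have hl : σ.loc t = N.hd a' := (mem_filter.1 ht).2
  -- By tameness only one sink here has positive demand. The balance says that it absorbs at least
  -- the flow on `a'`, although its demand is smaller.
  rw [sum_eq_single t (fun j hj' hjt => le_antisymm (not_lt.1 fun hp => hjt ?_)
    (hσ.dem_nonneg j)) (fun h => absurd ht h)] at hbal
  · have h1 := lt_of_le_of_ne (h t hpos hl) (hne t a' hpos hl.symm).symm
    linarith
  · have hlj : σ.loc j = N.hd a' := (mem_filter.1 hj').2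
    exact hT.unique j t (hirr j hp hlj) (hirr t hpos hl) trivial (hlj.trans hl.symm)

end State

end Network

end UnsplittableTransshipment

namespace UnsplittableTransshipment

open Finset

namespace Network

variable {V A : Type*} {N : Network V A} [Fintype V] [DecidableEq V] [Fintype A] [DecidableEq A]

variable {rk : Option V → ℕ} (hrk : ∀ a : N.Arc, rk (N.tl a) < rk (N.hd a))

/-! ### The invariants of the algorithm -/

namespace Config

/-- The invariants that hold in every configuration that occurs in an execution. -/
def Invariant : N.Config → Prop
  | .prelim σ => σ.Consistent
  | .loop σ => σ.Consistent ∧ (σ.Tame fun _ => True) ∧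
      ∀ t a, σ.Active t → N.hd a = σ.loc t → σ.flow a ≠ σ.dem t
  | .moving y₀ σ => σ.Consistent ∧ σ.Tame (SingularVertex y₀) ∧ ∀ a, 0 < σ.flow a → 0 < y₀ a

end Config

open State

theorem State.CanMove.dem_le {y₀ : N.Arc → ℝ} {σ : N.State} {t : N.Sink} {a : N.Arc}
    (h : σ.CanMove y₀ t a) : σ.dem t ≤ σ.flow a := by
  rcases h.2.2.2 with h | h
  exacts [h.2.ge, h.2]

include hrk in
theorem Config.Invariant.step {c c' : N.Config} (hc : c.Invariant) (h : Step c c') :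
    c'.Invariant := by
  cases h with
  | prelim_move h => exact State.Consistent.move hrk hc h.1 h.2.2.1 h.2.2.2
  | @prelim_end σ h =>
    have hirr : ∀ t, ¬ σ.Irregular t := by
      rintro t ⟨h1, a, h2, h3⟩
      exact h t a ⟨h1, h1.trans h3, h2, h3.le⟩
    refine ⟨hc, ⟨fun t ht => absurd ht (hirr t), fun t t' ht => absurd ht (hirr t)⟩, ?_⟩
    intro t a h1 h2 h3
    exact h t a ⟨h1, h3 ▸ h1, h2, h3.ge⟩
  | cycle hσ hC hε =>
    obtain ⟨h1, h2, h3⟩ := hc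
    have hε₀ := (hC.isLeast_pos hε).le
    exact ⟨h1.augment hC hε.2 hε₀, (h2.augment h3 hC hε.2 hε₀).mono fun _ _ => trivial,
      fun a => hC.augment_pos⟩
  | @singular σ a' t F hσ ha' ht hF =>
    obtain ⟨h1, h2, h3⟩ := hc
    obtain ⟨ht, hloc, hlt⟩ := ht
    have h4 := h1.routeDigraph hrk ha' ht hloc hF
    have hflow : (σ.routeDigraph a' t F).flow a' = σ.flow a' := if_neg fun h => h.2.1 rfl
    have hdem : (σ.routeDigraph a' t F).dem t = σ.flow a' := if_pos rfl
    have hsupp : ∀ a, 0 < (σ.routeDigraph a' t F).flow a → 0 < σ.flow a := by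
      intro a ha
      simp only [State.routeDigraph] at ha
      split_ifs at ha
      exacts [absurd ha (lt_irrefl _), ha]
    have ht' : (σ.routeDigraph a' t F).Active t := by rw [Active, hdem]; exact ha'.pos
    refine ⟨h4.move hrk ht' hloc.symm (by rw [hflow, hdem]),
      ((h2.mono fun _ _ => trivial).routeDigraph h1 hloc F).move (h4.dem_nonneg t)
        (by rw [hflow]; exact ha'.pos) fun hs => ⟨by rw [hflow, hdem], ?_⟩, fun a ha =>
        hsupp a (ha.trans_le (move_flow_le (h4.dem_nonneg t) a))⟩
    intro e he f hf
    exact hs _ .refl ⟨hsupp e he.1, he.2⟩ ⟨hsupp f hf.1, hf.2⟩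
  | @move y₀ σ t a h =>
    obtain ⟨h1, h2, h3⟩ := hc
    refine ⟨h1.move hrk h.1 h.2.2.1 h.dem_le, h2.move (h1.dem_nonneg t) h.2.1 fun hs => ?_,
      fun a ha => h3 a (ha.trans_le (move_flow_le (h1.dem_nonneg t) a))⟩
    have ha := h3 a h.2.1
    refine ⟨?_, fun e he f hf => hs _ .refl ⟨h3 e he.1, he.2⟩ ⟨h3 f hf.1, hf.2⟩⟩
    -- An arc with a singular tail is itself singular, so only the rule requiring equality can have
    -- applied.
    rcases h.2.2.2 with h' | h'
    · exact h'.2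
    · exact absurd ⟨ha, hs.head ha⟩ h'.1
  | @move_end y₀ σ h =>
    obtain ⟨h1, h2, h3⟩ := hc
    -- At any other location the entering arcs are non-singular, and an irregular sink could move
    -- along one of them. So tameness on the singular vertices is already full tameness.
    have hs : ∀ t, σ.Irregular t → SingularVertex y₀ (σ.loc t) := by
      rintro t ⟨h4, a, h5, h6⟩
      by_contra hn
      have hp := h4.trans h6
      refine h t a ⟨h4, hp, h5, .inr ⟨fun hs => hn (h5 ▸ hs.2), h6.le⟩⟩
    refine ⟨h1, ⟨fun t ht _ => h2.junction t ht (hs t ht),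
      fun t t' ht ht' _ => h2.unique t t' ht ht' (hs t ht)⟩, fun t a h4 h5 h6 => ?_⟩
    have hp : 0 < σ.flow a := h6 ▸ h4
    by_cases hsing : N.IsSingular y₀ a
    · exact h t a ⟨h4, hp, h5, .inl ⟨hsing, h6⟩⟩
    · exact h t a ⟨h4, hp, h5, .inr ⟨hsing, h6.ge⟩⟩

include hrk in
theorem Config.Invariant.exists_step {c : N.Config} (hc : c.Invariant)
    (h : ∀ σ, c = .loop σ → ¬ σ.Finished) : ∃ c', Step c c' := by
  cases c with
  | prelim σ =>
    by_cases h' : ∃ t a, σ.CanMovePrelim t a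
    · obtain ⟨t, a, h'⟩ := h'
      exact ⟨_, .prelim_move h'⟩
    · push Not at h'
      exact ⟨_, .prelim_end h'⟩
  | moving y₀ σ =>
    by_cases h' : ∃ t a, σ.CanMove y₀ t a
    · obtain ⟨t, a, h'⟩ := h'
      exact ⟨_, .move h'⟩
    · push Not at h'
      exact ⟨_, .move_end h'⟩
  | loop σ =>
    obtain ⟨h1, h2, h3⟩ := hc
    have hσ := h σ rfl
    by_cases h' : ∃ a', FindsSingularDigraph σ.flow a'
    · obtain ⟨a', ha'⟩ := h'
      obtain ⟨t, ht, hloc, hlt⟩ := h2.exists_large_sink h1 h3 ha'.pos ha'.junction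
      obtain ⟨F, hF⟩ := h1.exists_decomposition hrk ha' ht hloc hlt
      exact ⟨_, .singular hσ ha' ⟨ht, hloc, hlt⟩ hF⟩
    · push Not at h'
      obtain ⟨t, ht⟩ : ∃ t, σ.Active t := by
        by_contra! hn
        exact hσ hn
      have hbal := h1.balance _ (h1.loc_ne t ht)
      have hout : 0 ≤ ∑ a with N.tl a = σ.loc t, σ.flow a := sum_nonneg fun a _ => h1.flow_nonneg a
      have hdem : 0 < ∑ j with σ.loc j = σ.loc t, σ.dem j :=
        sum_pos' (fun j _ => h1.dem_nonneg j) ⟨t, by simp, ht⟩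
      obtain ⟨a, -, ha⟩ := exists_lt_of_sum_lt (s := {a | N.hd a = σ.loc t})
        (f := fun _ => (0 : ℝ)) (g := σ.flow) (by rw [sum_const_zero]; linarith)
      obtain ⟨C, hC⟩ := exists_cycle hrk h' ⟨a, ha⟩
      obtain ⟨ε, hε⟩ := hC.exists_isLeast hrk
      exact ⟨_, .cycle hσ hC hε⟩

/-! ### Termination -/

open Classical in
/-- The number of arcs in the current network plus a bound for the number of moves to come. -/
noncomputable def State.potential (σ : N.State) : ℕ :=
  Finset.card {a | 0 < σ.flow a} + ∑ t, (Fintype.card N.Arc - (σ.trace t).length)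

open Classical in
/-- This number decreases in every step of the algorithm. -/
noncomputable def Config.measure : N.Config → ℕ
  | .prelim σ => 3 * σ.potential + 3
  | .loop σ => 3 * σ.potential + 2
  | .moving y₀ σ => 3 * σ.potential + if ∃ t a, σ.CanMove y₀ t a then 1 else 3

theorem State.potential_le {σ σ' : N.State} (htr : σ'.trace = σ.trace)
    (hflow : ∀ a, 0 < σ'.flow a → 0 < σ.flow a) : σ'.potential ≤ σ.potential := by
  rw [potential, potential, htr]
  exact Nat.add_le_add_right (card_le_card fun a => by simpa using hflow a) _

theorem State.potential_lt {σ σ' : N.State} (htr : σ'.trace = σ.trace)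
    (hflow : ∀ a, 0 < σ'.flow a → 0 < σ.flow a) {a : N.Arc} (ha : 0 < σ.flow a)
    (ha' : σ'.flow a = 0) : σ'.potential < σ.potential := by
  classical
  rw [potential, potential, htr]
  refine Nat.add_lt_add_right (card_lt_card (Finset.ssubset_iff_subset_ne.2 ⟨?_, fun h => ?_⟩)) _
  · intro e
    simpa using hflow e
  · have : a ∈ ({a | 0 < σ.flow a} : Finset N.Arc) := by simpa using ha
    rw [← h] at this
    simp [ha'] at this

include hrk in
theorem State.potential_move_lt {σ : N.State} (hσ : σ.Consistent) {t : N.Sink} {a : N.Arc}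
    (ht : σ.Active t) (ha : N.hd a = σ.loc t) (hle : σ.dem t ≤ σ.flow a) :
    (σ.move t a).potential < σ.potential := by
  have hσ' := hσ.move hrk ht ha hle
  -- Truncated subtraction decreases strictly only because the longer trace is still free of
  -- repetitions.
  have hlen : ∀ j, ((σ.move t a).trace j).length ≤ Fintype.card N.Arc := fun j =>
    ((hσ'.trace_walk j).nodup hrk).length_le_card
  refine Nat.add_lt_add_of_le_of_lt (card_le_card fun e he => ?_)
    (sum_lt_sum (fun j _ => ?_) ⟨t, mem_univ t, ?_⟩)
  · simp only [mem_filter, mem_univ, true_and] at he ⊢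
    exact he.trans_le (move_flow_le (hσ.dem_nonneg t) e)
  · rw [move_trace]
    split_ifs with h
    · rw [h, List.length_cons]; omega
    · exact le_rfl
  · have := hlen t
    rw [move_trace, if_pos rfl, List.length_cons] at this ⊢
    omega

theorem Config.measure_moving_le (y₀ : N.Arc → ℝ) (σ : N.State) :
    (Config.moving y₀ σ).measure ≤ 3 * σ.potential + 3 := by
  rw [Config.measure]
  split_ifs <;> omega

include hrk in
-- The factor 3 leaves room for changes of phase. If `ε` is attained at a forward arc, that arc
-- disappears. Otherwise the potential may stay the same, but a move becomes possible, and the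
-- moving phase then counts 1 instead of 3.
theorem Config.Invariant.measure_lt {c c' : N.Config} (hc : c.Invariant) (h : Step c c') :
    c'.measure < c.measure := by
  cases h with
  | prelim_move h =>
    have := potential_move_lt hrk hc h.1 h.2.2.1 h.2.2.2
    simp only [Config.measure]
    omega
  | prelim_end h => simp [Config.measure]
  | @cycle σ C ε hσ hC hε =>
    rcases hε.1 with ⟨a, ha, h⟩ | ⟨a, ha, t, h1, h2, h3, h4⟩
    · have h0 := hC.augment_flow_forward (σ := σ) ha ε
      have := potential_lt (σ := σ) (σ' := σ.augment C ε) rfl (fun a => hC.augment_pos)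
        (hC.pos _ ha) (by rw [h0, h, sub_self])
      have := Config.measure_moving_le σ.flow (σ.augment C ε)
      simp only [Config.measure] at this ⊢
      omega
    · have h0 := hC.augment_flow_backward (σ := σ) ha ε
      rw [h4, add_sub_cancel] at h0
      have := potential_le (σ := σ) (σ' := σ.augment C ε) rfl fun a => hC.augment_pos
      -- The backward arc that determines `ε` is singular and now carries exactly the demand of `t`.
      have hm : ∃ t a, (σ.augment C ε).CanMove σ.flow t a :=
        ⟨t, a, h1, (by rw [← h4] at h0; rw [h0]; exact h1), h2.symm,
          .inl ⟨hC.singular _ ha rfl, by rw [← h4] at h0; exact h0⟩⟩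
      simp only [Config.measure, if_pos hm]
      omega
  | @singular σ a' t F hσ ha' ht hF =>
    obtain ⟨h1, -, -⟩ := hc
    obtain ⟨ht, hloc, hlt⟩ := ht
    have h4 := h1.routeDigraph hrk ha' ht hloc hF
    have hflow : (σ.routeDigraph a' t F).flow a' = σ.flow a' := if_neg fun h => h.2.1 rfl
    have hdem : (σ.routeDigraph a' t F).dem t = σ.flow a' := if_pos rfl
    have h5 := potential_le (σ := σ) (σ' := σ.routeDigraph a' t F) rfl (by
      intro a ha
      simp only [State.routeDigraph] at ha
      split_ifs at ha
      exacts [absurd ha (lt_irrefl _), ha])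
    have h6 := potential_move_lt hrk h4 (t := t) (a := a') (by rw [Active, hdem]; exact ha'.pos)
      hloc.symm (by rw [hflow, hdem])
    have := Config.measure_moving_le σ.flow ((σ.routeDigraph a' t F).move t a')
    simp only [Config.measure] at this ⊢
    omega
  | @move y₀ σ t a h =>
    have h5 := potential_move_lt hrk hc.1 h.1 h.2.2.1 h.dem_le
    have := Config.measure_moving_le y₀ (σ.move t a)
    have hm : ∃ t a, σ.CanMove y₀ t a := ⟨t, a, h⟩
    simp only [Config.measure, if_pos hm] at this ⊢
    omega
  | @move_end y₀ σ h =>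
    have hm : ¬ ∃ t a, σ.CanMove y₀ t a := by push Not; exact h
    simp [Config.measure, if_neg hm]

include hrk in
theorem Config.Invariant.acc {c : N.Config} (hc : c.Invariant) :
    Acc (fun c' c : N.Config => Step c c') c := by
  induction h : c.measure using Nat.strong_induction_on generalizing c with
  | _ n ih =>
    exact ⟨_, fun c' hc' => ih _ (h ▸ hc.measure_lt hrk hc') (hc.step hrk hc') rfl⟩

include hrk in
theorem Reachable.invariant {x : A → ℝ} (hx : N.IsTransshipment x) {c : N.Config}
    (hc : Reachable x c) : c.Invariant := by
  induction hc with
  | refl => exact consistent_init hx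
  | tail _ h ih => exact ih.step hrk h

/-! ### The output -/

theorem exists_dummy_cons {u : Option V} {v : V} {q : List N.Arc}
    (hq : IsWalk N.tl N.hd u q (some v)) (hu : u = none) :
    ∃ s q', q = .inr s :: q' ∧ IsWalk N.tl N.hd (some s.1) q' (some v) := by
  cases q with
  | nil => exact absurd (hu.symm.trans hq) (by simp)
  | cons a q =>
    obtain ⟨s, rfl⟩ := tl_eq_none.1 (hq.1.trans hu)
    exact ⟨s, q, rfl, hq.2⟩

theorem exists_eq_map_inl {u v : V} {q : List N.Arc} (hq : IsWalk N.tl N.hd (some u) q (some v)) :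
    ∃ p : List A, q = p.map .inl ∧ IsWalk N.tail N.head u p v := by
  induction q generalizing u with
  | nil => exact ⟨[], rfl, Option.some.inj hq⟩
  | cons a q ih =>
    rcases a with a | s
    · obtain ⟨p, rfl, hp⟩ := ih hq.2
      exact ⟨a :: p, rfl, Option.some.inj hq.1, hp⟩
    · exact absurd hq.1 (by simp [tl])

theorem exists_walk_of_dummy_walk {v : V} {q : List N.Arc}
    (hq : IsWalk N.tl N.hd none q (some v)) :
    ∃ (s : N.Source) (p : List A), q = .inr s :: p.map .inl ∧
      q.filterMap Sum.getLeft? = p ∧ IsWalk N.tail N.head s p v := by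
  obtain ⟨s, q', rfl, hq'⟩ := exists_dummy_cons hq rfl
  obtain ⟨p, rfl, hp⟩ := exists_eq_map_inl hq'
  refine ⟨s, p, rfl, ?_, hp⟩
  rw [List.filterMap_cons_none rfl, List.filterMap_map]
  exact List.filterMap_some

theorem mem_filterMap_getLeft? {q : List N.Arc} {a : A} :
    a ∈ q.filterMap Sum.getLeft? ↔ .inl a ∈ q := by
  simp [List.mem_filterMap, Sum.getLeft?_eq_some_iff]

variable {σ : N.State}

theorem State.mem_support_output {t : N.Sink} {p : List A} (hp : p ∈ (σ.output t).support) :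
    ∃ q ∈ (σ.routed t).support, q.filterMap Sum.getLeft? = p := by
  classical
  exact Finset.mem_image.1 (Finsupp.mapDomain_support hp)

theorem State.Consistent.output_total (hσ : σ.Consistent) (hf : σ.Finished) (t : N.Sink) :
    ((σ.output t).sum fun _ r => r) = |N.b t| := by
  have h0 : σ.dem t = 0 := le_antisymm (not_lt.1 (hf t)) (hσ.dem_nonneg t)
  rw [← hσ.total t, h0, add_zero, output, Finsupp.sum_mapDomain_index (by simp) (by simp)]

include hrk

/-- Uniqueness is the confluence invariant; the rest of each traced path leads to the root, and
ranks forbid leaving it. -/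
theorem State.Consistent.output_inTree (hσ : σ.Consistent) (t : N.Sink) :
    N.IsInTree {a | ∃ p ∈ (σ.output t).support, a ∈ p} t := by
  have hrk' : ∀ a, rk (some (N.tail a)) < rk (some (N.head a)) := fun a => hrk (.inl a)
  have hwalk : ∀ p ∈ (σ.output t).support, ∃ s, IsWalk N.tail N.head s p t := by
    intro p hp
    obtain ⟨q, hq, rfl⟩ := mem_support_output hp
    obtain ⟨s, p, -, h1, h2⟩ := exists_walk_of_dummy_walk (hσ.routed_walk t q hq)
    exact ⟨s, h1 ▸ h2⟩
  have hused : ∀ a, (∃ p ∈ (σ.output t).support, a ∈ p) → .inl a ∈ σ.used t := by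
    rintro a ⟨p, hp, ha⟩
    obtain ⟨q, hq, rfl⟩ := mem_support_output hp
    exact .inr ⟨q, hq, mem_filterMap_getLeft?.1 ha⟩
  constructor
  · rintro a ⟨p, hp, ha⟩ h
    obtain ⟨s, hs⟩ := hwalk p hp
    have h1 := (IsWalk.rank_mem (rk := fun v => rk (some v)) hrk' hs ha).2
    have h2 := hrk' a
    rw [h] at h2
    omega
  · intro a ha a' ha' h
    exact Sum.inl_injective (hσ.confluent t _ (hused a ha) _ (hused a' ha') (by simp [tl])
      (congrArg some h))
  · rintro a ⟨p, hp, ha⟩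
    obtain ⟨s, hs⟩ := hwalk p hp
    obtain ⟨q, q', rfl⟩ := List.append_of_mem ha
    obtain ⟨x, -, -, h⟩ := isWalk_append.1 hs
    exact ⟨q', h, fun e he => ⟨_, hp, by simp [he]⟩⟩

/-- With no demand left, flow in an acyclic network has nowhere to end. -/
theorem State.Consistent.dummy_flow_eq_zero (hσ : σ.Consistent) (hf : σ.Finished) (s : N.Source) :
    σ.flow (.inr s) = 0 := by
  have h0 : ∀ t, σ.dem t = 0 := fun t => le_antisymm (not_lt.1 (hf t)) (hσ.dem_nonneg t)
  by_contra hne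
  have hs : 0 < σ.flow (.inr s) := lt_of_le_of_ne (hσ.flow_nonneg _) (Ne.symm hne)
  obtain ⟨e, he, hmax⟩ := exists_max_image ({e | 0 < σ.flow e} : Finset N.Arc)
    (fun e => rk (N.hd e)) ⟨.inr s, by simpa using hs⟩
  have he : 0 < σ.flow e := by simpa using he
  have hbal := hσ.balance _ (hd_ne_none e)
  simp only [h0, sum_const_zero] at hbal
  have hin : 0 < ∑ a with N.hd a = N.hd e, σ.flow a :=
    sum_pos' (fun a _ => hσ.flow_nonneg a) ⟨e, by simp, he⟩
  obtain ⟨f, hf, hpos⟩ := exists_lt_of_sum_lt (s := {a | N.tl a = N.hd e})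
    (f := fun _ => (0 : ℝ)) (g := σ.flow) (by rw [sum_const_zero]; linarith)
  have h1 := hmax f (by simpa using hpos)
  have h2 := hrk f
  rw [(mem_filter.1 hf).2] at h2
  omega

open Classical in
-- Adding up the routed paths gives the balances in the extended network. The paths through the
-- dummy arc of `s` carry exactly `N.b s`, so dropping these arcs produces the supplies.
theorem State.Consistent.output_transshipment (hσ : σ.Consistent) (hf : σ.Finished) :
    N.IsTransshipment (N.arcFlow σ.output) := by
  let g : N.Arc → ℝ := fun a => ∑ t, (σ.routed t).sum fun q r => if a ∈ q then r else 0
  have hg : ∀ a, N.arcFlow σ.output a = g (.inl a) := by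
    intro a
    refine sum_congr rfl fun t _ => ?_
    rw [output, Finsupp.sum_mapDomain_index (by simp) (by intros; split_ifs <;> simp)]
    simp only [mem_filterMap_getLeft?]
  have hgs : ∀ s, g (.inr s) = N.b s := by
    intro s
    have := hσ.source s
    rwa [hσ.dummy_flow_eq_zero hrk hf, zero_add] at this
  have hsum : ∀ (f : N.Arc → Option V) v, ∑ a with f a = v, g a
      = ∑ t, (σ.routed t).sum fun q r => ∑ a with f a = v, if a ∈ q then r else 0 := by
    intro f v
    rw [sum_comm]
    exact sum_congr rfl fun t _ => (Finsupp.sum_finsetSum_comm _ _).symm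
  have hbal : ∀ v : V, (∑ a with N.tl a = some v, g a) - (∑ a with N.hd a = some v, g a)
      = - if N.b v < 0 then |N.b v| else 0 := by
    intro v
    rw [hsum, hsum, ← sum_sub_distrib]
    have : ∀ t : N.Sink,
        ((σ.routed t).sum fun q r => ∑ a with N.tl a = some v, if a ∈ q then r else 0)
        - ((σ.routed t).sum fun q r => ∑ a with N.hd a = some v, if a ∈ q then r else 0)
        = - if t.1 = v then |N.b t| else 0 := by
      intro t
      rw [← Finsupp.sum_sub]
      have h0 : σ.dem t = 0 := le_antisymm (not_lt.1 (hf t)) (hσ.dem_nonneg t)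
      rw [← hσ.total t, h0, add_zero]
      have h1 : (if t.1 = v then (σ.routed t).sum fun _ r => r else 0)
          = (σ.routed t).sum fun _ r => if t.1 = v then r else 0 := by
        split_ifs <;> simp
      rw [h1, Finsupp.sum, Finsupp.sum, ← sum_neg_distrib]
      refine sum_congr rfl fun q hq => ?_
      have := (hσ.routed_walk t q hq).balance hrk ((σ.routed t) q) (some v)
      simp only [reduceCtorEq, if_false, zero_sub, Option.some.injEq] at this
      convert this
    rw [sum_congr rfl fun t _ => this t, sum_neg_distrib]
    congr 1
    exact sum_subtype_ite_eq _ (fun v => |N.b v|) v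
  constructor
  · intro a
    rw [hg]
    exact sum_nonneg fun t _ => sum_nonneg fun q _ => by
      dsimp only
      split_ifs
      exacts [hσ.routed_nonneg t q, le_rfl]
  · intro v
    have h := hbal v
    simp only [sum_filter, Fintype.sum_sum_type, hgs] at h
    simp only [sum_filter, hg]
    simp only [tl, hd, Option.some.injEq, reduceCtorEq, if_false, sum_const_zero, add_zero] at h
    have h1 : (∑ s : N.Source, if s.1 = v then N.b s else 0) = if 0 < N.b v then N.b v else 0 :=
      sum_subtype_ite_eq _ N.b v
    rw [h1] at h
    rcases lt_trichotomy (N.b v) 0 with h3 | h3 | h3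
    · rw [if_neg (not_lt.2 h3.le), if_pos h3, abs_of_neg h3] at h; linarith
    · rw [h3] at h ⊢; simp only [lt_irrefl, if_false] at h; linarith
    · rw [if_pos h3, if_neg (not_lt.2 h3.le)] at h; linarith

theorem State.Consistent.output_unsplittable (hσ : σ.Consistent) (hf : σ.Finished) :
    N.IsUnsplittable σ.output where
  transshipment := hσ.output_transshipment hrk hf
  path t p hp := by
    refine ⟨lt_of_le_of_ne (Finsupp.mapDomain_nonneg (hσ.routed_nonneg t) p)
      (Finsupp.mem_support_iff.1 hp).symm, ?_⟩
    obtain ⟨q, hq, rfl⟩ := mem_support_output hp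
    obtain ⟨s, p, -, h1, h2⟩ := exists_walk_of_dummy_walk (hσ.routed_walk t q hq)
    rw [h1]
    exact ⟨s, h2, h2.nodup_vertices (rk := fun v => rk (some v)) fun a => hrk (.inl a)⟩
  -- Two paths with the same ends inside one in-tree coincide.
  unique t s p hp q hq hsp hsq :=
    hsp.1.eq_of_unique (rk := fun v => rk (some v)) (fun a => hrk (.inl a)) hsq.1
      fun a ha a' ha' => (hσ.output_inTree hrk t).unique a ⟨p, hp, ha⟩ a' ⟨q, hq, ha'⟩

end Network

end UnsplittableTransshipment

/-! ### Termination, progress and correctness combined -/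

open UnsplittableTransshipment Network in
theorem mainTheorem2 {V A : Type*} [Fintype V] [DecidableEq V] [Fintype A] [DecidableEq A]
    (N : Network V A) (hN : N.Acyclic) (hb : ∑ v, N.b v = 0)
    (x : A → ℝ) (hx : N.IsTransshipment x) :
    -- every execution is finite
    Acc (fun c' c : N.Config => Step c c') (.prelim (N.init x)) ∧
    -- an execution stops only when all (sub-)sinks have reached the super-source
    (∀ c : N.Config, Reachable x c → (¬ ∃ c', Step c c') →
      ∃ σ : N.State, c = .loop σ ∧ σ.Finished) ∧
    -- and then the output is an unsplittable transshipment with confluent routing for every sink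
    (∀ σ : N.State, Reachable x (.loop σ) → σ.Finished →
      N.IsUnsplittable σ.output ∧ ∀ t, N.RoutedConfluently σ.output t) := by
  obtain ⟨rk, hrk⟩ := hN.exists_rank
  refine ⟨Config.Invariant.acc hrk (State.consistent_init hx), fun c hc hstuck => ?_,
    fun σ hσ hf => ?_⟩
  · by_contra! h
    exact hstuck ((Reachable.invariant hrk hx hc).exists_step hrk h)
  · have h := (Reachable.invariant hrk hx hσ).1
    exact ⟨h.output_unsplittable hrk hf, fun t => ⟨h.output_total hf t, h.output_inTree hrk t⟩⟩
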